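/- Let $\mathcal X\subseteq\mathbb R^d$ and let $x\mapsto\rho(x)$ map each $x\in\mathcal X$ to a density matrix (positive semidefinite, unit trace) on $\mathbb C^{d_H}$. For $r\in[1,\infty]$ and $b\ge 0$ let $\mathcal A_r=\{A=A^\dagger\in\mathbb C^{d_H\times d_H}:\|A\|_r\le b\}$, with $\|\cdot\|_r$ the Schatten norm. Let $K\ge 2$. For $\mathbf A=(A_1,\dots,A_K)\in\mathcal A_r^K$ consider the $K$-class classifier $g(x)=\arg\max_{k}\mathrm{Tr}(A_k\rho(x))$; its loss in the state $\rho'$ with label $y\in[K]$ is $$\ell(\mathbf A,\rho',y)=\phi_\gamma\Big(\mathrm{Tr}(A_y\rho')-\max_{k\ne y}\mathrm{Tr}(A_k\rho')\Big),$$ where $\gamma>0$ and $\phi_\gamma(t)=1$ for $t\le 0$, $\phi_\gamma(t)=1-t/\gamma$ for $0<t<\gamma$, $\phi_\gamma(t)=0$ for $t\ge\gamma$. For $p\in[1,\infty]$ and $\varepsilon\ge0$, a classical adversary can replace $\rho(x)$ by any state in $T^C(x)=\{\rho(x'):x'\in\mathcal X,\ \|x-x'\|_p\le\varepsilon\}$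 ($\ell_p$ norm), and a quantum adversary by any state in $T^Q(x)=\{\rho'\text{ a density matrix}:\|\rho(x)-\rho'\|_p\le\varepsilon\}$ (Schatten $p$-norm). For $\bullet\in\{C,Q\}$ the adversarial loss is $\ell^\bullet(\mathbf A,x,y)=\sup_{\rho'\in T^\bullet(x)}\ell(\mathbf A,\rho',y)$. For a sample $(x_1,y_1),\dots,(x_m,y_m)\in\mathcal X\times[K]$ with $m\ge1$, and $\boldsymbol\sigma$ uniform on $\{\pm1\}^m$, define $$\mathcal R^\bullet=\mathbb E_{\boldsymbol\sigma}\Big[\sup_{\mathbf A\in\mathcal A_r^K}\frac1m\sum_{i=1}^m\sigma_i\,\ell^\bullet(\mathbf A,x_i,y_i)\Big],\qquad \mathcal R(\Pi(\mathcal F_K))=\mathbb E_{\boldsymbol\sigma}\Big[\sup_{k\in[K],\,A_k\in\mathcal A_r}\frac1m\sum_{i=1}^m\sigma_i\mathrm{Tr}(A_k\rho(x_i))\Big],$$ $$\mathcal S^\bullet=d_H\sup_{x\in\mathcal X,\ \rho'\in T^\bullet(x)}\|\rho(x)-\rho'\|_{\frac r{r-1}}\qquad\Big(\tfrac r{r-1}=\infty\text{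 for }r=1,\ \tfrac r{r-1}=1\text{ for }r=\infty\Big).$$ Theorem. There are a function $J':[1,\infty]\to[0,\infty)$ and a constant $c$ with $J'(r)\le c\sqrt{1+1/r}$ for all $r$ such that, for all choices of the above data and both for classical ($\bullet=C$) and quantum ($\bullet=Q$) attacks, $$\mathcal R^\bullet\ \le\ \frac{2K}{\gamma}\,\mathcal R(\Pi(\mathcal F_K))+\frac{K\,b\,\mathcal S^\bullet J'(r)}{\gamma\sqrt m}.$$ Moreover $\mathcal R(\Pi(\mathcal F_K))$ equals the Rademacher complexity $\mathbb E_{\boldsymbol\sigma}\big[\sup_{A\in\mathcal A_r}\frac1m\sum_i\sigma_i\mathrm{Tr}(A\rho(x_i))\big]$ of the binary class, so every bound on the latter applies to it. -/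

import Mathlib

open scoped ENNReal ComplexOrder

noncomputable section

namespace QClassifier

/-- The empirical Rademacher complexity `E_σ [ sup_{a ∈ V} (1/m) ∑ i, σ i * a i ]` of a set `V`
of vectors in `ℝ^m`, where `σ` is uniform on `{+1, -1}^m`. -/
def rademacher {m : ℕ} (V : Set (Fin m → ℝ)) : ℝ :=
  (∑ σ : Fin m → ℤˣ,
      sSup ((fun a : Fin m → ℝ => (1 / (m : ℝ)) * ∑ i, (((σ i : ℤ) : ℝ)) * a i) '' V)) /
    (2 : ℝ) ^ m

/-- The `ℓ_p` norm of a vector in `ℝ^d`, for `p ∈ [1, ∞]`. -/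
def lpNorm {d : ℕ} (p : ℝ≥0∞) (v : Fin d → ℝ) : ℝ :=
  ‖(WithLp.toLp p v : PiLp p (fun _ : Fin d => ℝ))‖

/-- The singular values of `A`: the eigenvalues of `|A| = √(Aᴴ A)`, that is, the square roots of
the eigenvalues of `Aᴴ A`, with multiplicity. -/
def singularValue {n : ℕ} (A : Matrix (Fin n) (Fin n) ℂ) (i : Fin n) : ℝ :=
  √((Matrix.isHermitian_conjTranspose_mul_self A).eigenvalues i)

/-- The Schatten norm `‖A‖_r = (Tr |A|^r)^(1/r)` for `r ∈ [1, ∞)`, and the largest eigenvalue of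
`|A|` for `r = ∞`: the `ℓ_r` norm of the vector of singular values. -/
def schattenNorm {n : ℕ} (r : ℝ≥0∞) (A : Matrix (Fin n) (Fin n) ℂ) : ℝ :=
  lpNorm r (singularValue A)

/-- Density matrices: positive semidefinite (hence Hermitian) of trace one. -/
def IsDensity {n : ℕ} (ρ : Matrix (Fin n) (Fin n) ℂ) : Prop :=
  ρ.PosSemidef ∧ ρ.trace = 1

/-- The observables: Hermitian matrices with Schatten `r`-norm at most `b`. -/
def observables (n : ℕ) (r : ℝ≥0∞) (b : ℝ) : Set (Matrix (Fin n) (Fin n) ℂ) :=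
  {A | A.IsHermitian ∧ schattenNorm r A ≤ b}

/-- The expectation `Tr (A ρ)` of an observable in a state (a real number if both matrices are
Hermitian). -/
def score {n : ℕ} (A ρ : Matrix (Fin n) (Fin n) ℂ) : ℝ :=
  (Matrix.trace (A * ρ)).re

/-- The margin `v y - max_{k ≠ y} v k` of a vector of class scores at the label `y`. -/
def margin {K : ℕ} (v : Fin K → ℝ) (y : Fin K) : ℝ :=
  v y - ⨆ k : {k : Fin K // k ≠ y}, v k

/-- The `γ`-ramp loss. -/
def ramp (γ t : ℝ) : ℝ :=
  if t ≤ 0 then 1 else if t < γ then 1 - t / γ else 0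

/-- The margin loss in the state `ρ` with label `y`, of the `K`-class classifier given by the
observables `A k`. -/
def loss {n K : ℕ} (γ : ℝ) (A : Fin K → Matrix (Fin n) (Fin n) ℂ)
    (ρ : Matrix (Fin n) (Fin n) ℂ) (y : Fin K) : ℝ :=
  ramp γ (margin (fun k => score (A k) ρ) y)

/-- The states that a `(p, ε)`-classical adversary can produce from the feature vector `x`: the
embeddings `emb x'` of the feature vectors `x' ∈ X` at `ℓ_p` distance at most `ε` from `x`. -/
def classicalAttack {d n : ℕ} (X : Set (Fin d → ℝ))
    (emb : (Fin d → ℝ) → Matrix (Fin n) (Fin n) ℂ) (p : ℝ≥0∞) (ε : ℝ) (x : Fin d → ℝ) :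
    Set (Matrix (Fin n) (Fin n) ℂ) :=
  emb '' {x' | x' ∈ X ∧ lpNorm p (x - x') ≤ ε}

/-- The states that a `(p, ε)`-quantum adversary can produce from the feature vector `x`: the
density matrices at Schatten `p`-distance at most `ε` from the state `emb x`. -/
def quantumAttack {d n : ℕ} (emb : (Fin d → ℝ) → Matrix (Fin n) (Fin n) ℂ)
    (p : ℝ≥0∞) (ε : ℝ) (x : Fin d → ℝ) : Set (Matrix (Fin n) (Fin n) ℂ) :=
  {ρ' | IsDensity ρ' ∧ schattenNorm p (emb x - ρ') ≤ ε}

/-- The adversarial loss at `(x, y)` if the adversary can produce the states in `attack x`. -/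
def advLoss {d n K : ℕ} (attack : (Fin d → ℝ) → Set (Matrix (Fin n) (Fin n) ℂ)) (γ : ℝ)
    (A : Fin K → Matrix (Fin n) (Fin n) ℂ) (x : Fin d → ℝ) (y : Fin K) : ℝ :=
  sSup ((fun ρ' => loss γ A ρ' y) '' attack x)

/-- The adversarial Rademacher complexity, on the sample `(x i, y i)`, of the class of `K`-class
classifiers whose observables have Schatten `r`-norm at most `b`. -/
def advRademacher {d n K m : ℕ} (attack : (Fin d → ℝ) → Set (Matrix (Fin n) (Fin n) ℂ))
    (r : ℝ≥0∞) (b γ : ℝ) (x : Fin m → Fin d → ℝ) (y : Fin m → Fin K) : ℝ :=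
  rademacher {a : Fin m → ℝ | ∃ A : Fin K → Matrix (Fin n) (Fin n) ℂ,
    (∀ k, A k ∈ observables n r b) ∧ a = fun i => advLoss attack γ A (x i) (y i)}

/-- The Rademacher complexity, on the sample `x i`, of the (binary) class of the functions
`x ↦ Tr (A (emb x))` with `A` an observable of Schatten `r`-norm at most `b`. -/
def binaryRademacher {d n m : ℕ} (emb : (Fin d → ℝ) → Matrix (Fin n) (Fin n) ℂ)
    (r : ℝ≥0∞) (b : ℝ) (x : Fin m → Fin d → ℝ) : ℝ :=
  rademacher {a : Fin m → ℝ | ∃ A ∈ observables n r b, a = fun i => score A (emb (x i))}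

/-- The Rademacher complexity, on the sample `x i`, of the class of all the component functions
`x ↦ f_k x = Tr (A_k (emb x))`, `k ∈ [K]`, of the score functions of `K`-class classifiers. -/
def componentRademacher {d n m : ℕ} (K : ℕ) (emb : (Fin d → ℝ) → Matrix (Fin n) (Fin n) ℂ)
    (r : ℝ≥0∞) (b : ℝ) (x : Fin m → Fin d → ℝ) : ℝ :=
  rademacher {a : Fin m → ℝ | ∃ A : Fin K → Matrix (Fin n) (Fin n) ℂ,
    (∀ k, A k ∈ observables n r b) ∧ ∃ k, a = fun i => score (A k) (emb (x i))}

/-- The dimension `n` times the largest Schatten distance, for the exponent `r / (r - 1)`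
conjugate to `r`, between the state of a feature vector `x ∈ X` and a state that the adversary can
produce from `x`. -/
def excess {d n : ℕ} (X : Set (Fin d → ℝ)) (emb : (Fin d → ℝ) → Matrix (Fin n) (Fin n) ℂ)
    (attack : (Fin d → ℝ) → Set (Matrix (Fin n) (Fin n) ℂ)) (r : ℝ≥0∞) : ℝ :=
  (n : ℝ) * sSup {s : ℝ | ∃ x ∈ X, ∃ ρ' ∈ attack x,
    s = schattenNorm (ENNReal.conjExponent r) (emb x - ρ')}

end QClassifier

end

noncomputable section

set_option linter.unusedSectionVars false

namespace QClassifier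

/-! ### Rademacher sums: contraction by averages and Massart's lemma -/

section RadSum

variable {ι T : Type*} [Fintype ι] [DecidableEq ι] [Fintype T] [Nonempty T]

/-! The suprema over observables and over attacks are first replaced by finitely many
near-maximisers `A t` and near-optimal attack states `ρ' i t`. A score in an attacked state is the
clean score plus `Tr (A_k (ρ' - ρ(x)))`. The numbers of the second kind form a vector `v t`, which
by Hölder has sup norm at most `b` times the attack distance, and which lies in a space of real
dimension at most `2 K n²`, whatever the sample size. Since `γ` times the ramp is 1-Lipschitz, an
increment of `γ` times the adversarial loss is at most the largest increment of `f_y - f_k` in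
modulus, plus `2 ‖v t - v t'‖`, plus a small error.

The engine is `radSum_le_of_average`: if the increments of each `ψ i` are dominated by a weighted
average, of total weight at most one, of the absolute increments of functions `w i ω`, then up to
the error the Rademacher sum of `ψ` is at most the largest one obtained by choosing a single `w i
ω`, or zero, for each `i`. The two parts of the increment must therefore share a total weight of
one.

For the score differences the `w` are the combinations `2 ∑ ± f_j`; coefficients of modulus at most
2 produce the leading constant `2 K`. Fair signs guarantee only a mean of half of `|D_y - D_k|`,
which would use up the whole weight. The nine patterns of `five_abs_sub_le_average` reach 5/9 and so
need weight 9/10 only.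

The remaining 1/10 pays for `‖v t - v t'‖`. Nets of balls give `v` a digital expansion
(`exists_digits`), the norm is dominated by indicators of distinct codes over all scales, and an
indicator is an average of random sign differences. Massart's lemma at each scale and a convergent
sum over scales give a constant times `ρ √(m D)`, with no logarithm of `m`. With `D = 2 K n² ≤ (K
n)²` this is the second term, with `J'` constant. -/

/-- The unnormalised Rademacher average of a finite family of vectors. -/
def radSum (f : ι → T → ℝ) : ℝ :=
  ∑ σ : ι → ℤˣ, ⨆ t, ∑ i, ((σ i : ℤ) : ℝ) * f i t

theorem le_ciSup_fintype (g : T → ℝ) (t : T) : g t ≤ ⨆ t, g t :=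
  le_ciSup (Set.finite_range g).bddAbove t

theorem radSum_le_of_forall {f : ι → T → ℝ} {B : (ι → ℤˣ) → ℝ}
    (h : ∀ σ t, ∑ i, ((σ i : ℤ) : ℝ) * f i t ≤ B σ) : radSum f ≤ ∑ σ, B σ :=
  Finset.sum_le_sum fun σ _ => ciSup_le (h σ)

theorem radSum_add_le (f g : ι → T → ℝ) :
    radSum (fun i t => f i t + g i t) ≤ radSum f + radSum g := by
  rw [radSum, radSum, radSum, ← Finset.sum_add_distrib]
  refine radSum_le_of_forall fun σ t => ?_
  simp only [mul_add, Finset.sum_add_distrib]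
  exact add_le_add (le_ciSup_fintype (fun t => ∑ i, ((σ i : ℤ) : ℝ) * f i t) t)
    (le_ciSup_fintype (fun t => ∑ i, ((σ i : ℤ) : ℝ) * g i t) t)

theorem radSum_zero : radSum (fun (_ : ι) (_ : T) => (0 : ℝ)) = 0 := by
  simp [radSum]

theorem radSum_sum_le {κ : Type*} (s : Finset κ) (f : κ → ι → T → ℝ) :
    radSum (fun i t => ∑ k ∈ s, f k i t) ≤ ∑ k ∈ s, radSum (f k) := by
  classical
  induction s using Finset.induction_on with
  | empty => simp [radSum_zero]
  | insert k s hk ih =>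
    simp only [Finset.sum_insert hk]
    exact (radSum_add_le _ _).trans (by gcongr)

theorem radSum_const_mul {c : ℝ} (hc : 0 ≤ c) (f : ι → T → ℝ) :
    radSum (fun i t => c * f i t) = c * radSum f := by
  simp only [radSum, Finset.mul_sum]
  refine Finset.sum_congr rfl fun σ _ => ?_
  rw [Real.mul_iSup_of_nonneg hc]
  refine iSup_congr fun t => ?_
  rw [Finset.mul_sum]
  exact Finset.sum_congr rfl fun i _ => by ring

/-- Flipping one sign. -/
def flipSign (i : ι) (σ : ι → ℤˣ) : ι → ℤˣ := Function.update σ i (-σ i)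

theorem flipSign_involutive (i : ι) : Function.Involutive (flipSign i) := fun σ => by
  simp [flipSign]

theorem sum_flipSign (i : ι) (F : (ι → ℤˣ) → ℝ) : ∑ σ, F (flipSign i σ) = ∑ σ, F σ :=
  Equiv.sum_comp (flipSign_involutive i).toPerm F

theorem sum_sign_update (f : ι → T → ℝ) (i : ι) (w : T → ℝ) (σ : ι → ℤˣ) (t : T) :
    ∑ j, ((σ j : ℤ) : ℝ) * Function.update f i w j t =
      ∑ j ∈ Finset.univ.erase i, ((σ j : ℤ) : ℝ) * f j t + ((σ i : ℤ) : ℝ) * w t := by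
  rw [← Finset.sum_erase_add _ _ (Finset.mem_univ i), Function.update_self]
  congr 1
  refine Finset.sum_congr rfl fun j hj => ?_
  rw [Function.update_of_ne (Finset.ne_of_mem_erase hj)]

theorem sum_flipSign_update (f : ι → T → ℝ) (i : ι) (w : T → ℝ) (σ : ι → ℤˣ) (t : T) :
    ∑ j, ((flipSign i σ j : ℤ) : ℝ) * Function.update f i w j t =
      ∑ j ∈ Finset.univ.erase i, ((σ j : ℤ) : ℝ) * f j t - ((σ i : ℤ) : ℝ) * w t := by
  rw [sum_sign_update]
  have h1 : ∑ j ∈ Finset.univ.erase i, ((flipSign i σ j : ℤ) : ℝ) * f j t =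
      ∑ j ∈ Finset.univ.erase i, ((σ j : ℤ) : ℝ) * f j t := by
    refine Finset.sum_congr rfl fun j hj => ?_
    rw [flipSign, Function.update_of_ne (Finset.ne_of_mem_erase hj)]
  rw [h1, flipSign, Function.update_self]
  push_cast
  ring

theorem sign_cast_cases (u : ℤˣ) : ((u : ℤ) : ℝ) = 1 ∨ ((u : ℤ) : ℝ) = -1 := by
  rcases Int.units_eq_one_or u with h | h <;> simp [h]

/-- Replacing the `i`-th function by `w` in a pair of conjugate suprema dominates the increments
of `w`. -/
theorem add_abs_le_iSup_update (f : ι → T → ℝ) (i : ι) (w : T → ℝ) (σ : ι → ℤˣ) (a a' : T) :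
    ∑ j ∈ Finset.univ.erase i, ((σ j : ℤ) : ℝ) * f j a +
        ∑ j ∈ Finset.univ.erase i, ((σ j : ℤ) : ℝ) * f j a' + |w a - w a'| ≤
      (⨆ t, ∑ j, ((σ j : ℤ) : ℝ) * Function.update f i w j t) +
        ⨆ t, ∑ j, ((flipSign i σ j : ℤ) : ℝ) * Function.update f i w j t := by
  have h1 := fun t => le_ciSup_fintype
    (fun t => ∑ j, ((σ j : ℤ) : ℝ) * Function.update f i w j t) t
  have h2 := fun t => le_ciSup_fintype
    (fun t => ∑ j, ((flipSign i σ j : ℤ) : ℝ) * Function.update f i w j t) t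
  have e1 := fun t => sum_sign_update f i w σ t
  have e2 := fun t => sum_flipSign_update f i w σ t
  simp only [e1, e2] at h1 h2 ⊢
  have h1a := h1 a
  have h1b := h1 a'
  have h2a := h2 a
  have h2b := h2 a'
  rcases sign_cast_cases (σ i) with hs | hs <;> rw [hs] at h1a h1b h2a h2b ⊢ <;>
    rcases abs_cases (w a - w a') with ⟨h, _⟩ | ⟨h, _⟩ <;> rw [h] <;> linarith

/-- Replacing one function by an average. -/
theorem radSum_update_le {Ω : Type*} [Fintype Ω] (f : ι → T → ℝ) (i : ι) (q : Ω → ℝ)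
    (w : Ω → T → ℝ) (hq : ∀ ω, 0 ≤ q ω) (hq1 : ∑ ω, q ω ≤ 1) (e : ℝ)
    (h : ∀ a a', f i a - f i a' ≤ ∑ ω, q ω * |w ω a - w ω a'| + e) :
    2 * radSum f ≤ ∑ ω, q ω * (2 * radSum (Function.update f i (w ω))) +
      (1 - ∑ ω, q ω) * (2 * radSum (Function.update f i 0)) + 2 ^ Fintype.card ι * e := by
  have key : ∀ g : ι → T → ℝ, 2 * radSum g = ∑ σ : ι → ℤˣ,
      ((⨆ t, ∑ j, ((σ j : ℤ) : ℝ) * g j t) + ⨆ t, ∑ j, ((flipSign i σ j : ℤ) : ℝ) * g j t) := by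
    intro g
    rw [Finset.sum_add_distrib,
      sum_flipSign i fun σ => ⨆ t, ∑ j, ((σ j : ℤ) : ℝ) * g j t, radSum]
    ring
  have hcard : (2 : ℝ) ^ Fintype.card ι * e = ∑ _σ : ι → ℤˣ, e := by
    simp [Fintype.card_pi]
  simp only [key, hcard, Finset.mul_sum]
  rw [Finset.sum_comm, ← Finset.sum_add_distrib, ← Finset.sum_add_distrib]
  refine Finset.sum_le_sum fun σ _ => ?_
  -- Maximisers for `σ` and for its flip: the terms away from `i` carry the same signs in both, and
  -- those at `i` combine to `σ i * (f i a - f i a')`, an increment.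
  obtain ⟨a, ha⟩ := exists_eq_ciSup_of_finite (f := fun t => ∑ j, ((σ j : ℤ) : ℝ) * f j t)
  obtain ⟨a', ha'⟩ := exists_eq_ciSup_of_finite
    (f := fun t => ∑ j, ((flipSign i σ j : ℤ) : ℝ) * f j t)
  rw [← ha, ← ha']
  have hA := sum_sign_update f i (f i) σ a
  have hA' := sum_flipSign_update f i (f i) σ a'
  rw [Function.update_eq_self] at hA hA'
  have hq0 := add_abs_le_iSup_update f i 0 σ a a'
  have hqw := fun ω => add_abs_le_iSup_update f i (w ω) σ a a'
  have haa : ((σ i : ℤ) : ℝ) * f i a - ((σ i : ℤ) : ℝ) * f i a' ≤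
      ∑ ω, q ω * |w ω a - w ω a'| + e := by
    rcases sign_cast_cases (σ i) with hs | hs
    · rw [hs]; linarith [h a a']
    · have := h a' a
      simp only [abs_sub_comm (w _ a') (w _ a)] at this
      rw [hs]; linarith
  simp only [hA, hA']
  set Ra := ∑ j ∈ Finset.univ.erase i, ((σ j : ℤ) : ℝ) * f j a
  set Ra' := ∑ j ∈ Finset.univ.erase i, ((σ j : ℤ) : ℝ) * f j a'
  have h3 : ∑ ω, q ω * (Ra + Ra' + |w ω a - w ω a'|) ≤ _ :=
    Finset.sum_le_sum fun ω _ => mul_le_mul_of_nonneg_left (hqw ω) (hq ω)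
  -- The missing mass `1 - ∑ q` is put on the zero function.
  have h4 := mul_le_mul_of_nonneg_left hq0 (sub_nonneg.2 hq1)
  simp only [mul_add (q _) (Ra + Ra'), Finset.sum_add_distrib, ← Finset.sum_mul] at h3
  simp only [Pi.zero_apply, sub_self, abs_zero, add_zero] at h4
  linarith

/-- **Contraction by averages.** If the increments of every `ψ i` are dominated by an average of
the increments of functions `w i ω`, then the Rademacher average of `ψ` is dominated by that of a
selection of the `w i ω`. -/
theorem radSum_le_of_average {Ω : Type*} [Fintype Ω] (ψ : ι → T → ℝ) (q : Ω → ℝ)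
    (w : ι → Ω → T → ℝ) (hq : ∀ ω, 0 ≤ q ω) (hq1 : ∑ ω, q ω ≤ 1) (e : ℝ) (he : 0 ≤ e)
    (h : ∀ i a a', ψ i a - ψ i a' ≤ ∑ ω, q ω * |w i ω a - w i ω a'| + e) (B : ℝ)
    (hB : ∀ ω : ι → Option Ω, radSum (fun i => (ω i).elim 0 (w i)) ≤ B) :
    radSum ψ ≤ B + Fintype.card ι * 2 ^ Fintype.card ι * e := by
  -- Here `s` is the set of indices at which `ψ` has not yet been replaced.
  suffices H : ∀ s : Finset ι, ∀ f : ι → T → ℝ, (∀ i ∈ s, f i = ψ i) →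
      (∀ i ∉ s, ∃ ω : Option Ω, f i = ω.elim 0 (w i)) →
      radSum f ≤ B + s.card * 2 ^ Fintype.card ι * e by
    simpa using H Finset.univ ψ (fun _ _ => rfl) (by simp)
  intro s
  induction s using Finset.induction_on with
  | empty =>
    intro f _ hf
    choose ω hω using fun i => hf i (Finset.notMem_empty i)
    have : f = fun i => (ω i).elim 0 (w i) := funext hω
    rw [this]
    simpa using hB ω
  | insert i s hi ih =>
    intro f h1 h2
    have hstep : ∀ o : Option Ω, radSum (Function.update f i (o.elim 0 (w i))) ≤
        B + s.card * 2 ^ Fintype.card ι * e := by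
      intro o
      apply ih
      · intro j hj
        rw [Function.update_of_ne (ne_of_mem_of_not_mem hj hi)]
        exact h1 j (Finset.mem_insert_of_mem hj)
      · intro j hj
        by_cases hji : j = i
        · subst hji; exact ⟨o, by simp⟩
        · rw [Function.update_of_ne hji]
          exact h2 j (by simp [hji, hj])
    have hfi := h1 i (Finset.mem_insert_self i s)
    have h3 := radSum_update_le f i q (w i) hq hq1 e (by rw [hfi]; exact h i)
    have h4 : ∑ ω, q ω * (2 * radSum (Function.update f i (w i ω))) ≤
        ∑ ω, q ω * (2 * (B + s.card * 2 ^ Fintype.card ι * e)) :=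
      Finset.sum_le_sum fun ω _ => mul_le_mul_of_nonneg_left
        (mul_le_mul_of_nonneg_left (hstep (some ω)) zero_le_two) (hq ω)
    have h5 := mul_le_mul_of_nonneg_left
      (mul_le_mul_of_nonneg_left (hstep none) (zero_le_two (α := ℝ))) (sub_nonneg.2 hq1)
    rw [← Finset.sum_mul] at h4
    rw [Finset.card_insert_of_notMem hi]
    push_cast
    have h6 : 0 ≤ (2 : ℝ) ^ Fintype.card ι * e := by positivity
    simp only [Option.elim] at h5
    nlinarith

/-- Contraction with the one-point average: each factor `c i` is raised to `C` in turn, which can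
only enlarge absolute increments. -/
theorem radSum_mul_le (c : ι → ℝ) (C : ℝ) (hC : 0 ≤ C) (hc : ∀ i, |c i| ≤ C) (f : ι → T → ℝ) :
    radSum (fun i t => c i * f i t) ≤ C * radSum f := by
  rw [← radSum_const_mul hC]
  suffices H : ∀ s : Finset ι,
      radSum (fun i t => c i * f i t) ≤ radSum fun i t => (if i ∈ s then C else c i) * f i t by
    simpa using H Finset.univ
  intro s
  induction s using Finset.induction_on with
  | empty => simp
  | insert i s hi ih =>
    refine ih.trans ?_
    have h := radSum_update_le (Ω := Unit) (fun i t => (if i ∈ s then C else c i) * f i t) i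
      (fun _ => 1) (fun _ t => C * f i t) (by simp) (by simp) 0 fun a a' => by
        simp only [hi, if_false, Finset.univ_unique, Finset.sum_const, Finset.card_singleton,
          one_smul, one_mul, add_zero]
        rw [← mul_sub, ← mul_sub, abs_mul, abs_of_nonneg hC]
        refine (le_abs_self _).trans ?_
        rw [abs_mul]
        exact mul_le_mul_of_nonneg_right (hc i) (abs_nonneg _)
    have h2 : Function.update (fun i t => (if i ∈ s then C else c i) * f i t) i
        (fun t => C * f i t) = fun j t => (if j ∈ insert i s then C else c j) * f j t := by
      funext j
      by_cases hj : j = i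
      · subst hj; simp
      · simp [hj]
    simp only [h2] at h
    simp at h
    simpa using h

/-- The signs are independent, so the sum factors into terms `2 cosh (g i)`, and `cosh u ≤ exp (u² /
2)`. -/
theorem sum_sign_exp_le (g : ι → ℝ) (C : ℝ) (hg : ∀ i, |g i| ≤ C) :
    ∑ σ : ι → ℤˣ, Real.exp (∑ i, ((σ i : ℤ) : ℝ) * g i) ≤
      2 ^ Fintype.card ι * Real.exp (Fintype.card ι * (C ^ 2 / 2)) := by
  have h1 : ∑ σ : ι → ℤˣ, Real.exp (∑ i, ((σ i : ℤ) : ℝ) * g i) =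
      ∏ i, ∑ u : ℤˣ, Real.exp (((u : ℤ) : ℝ) * g i) := by
    simp only [Real.exp_sum]
    rw [Finset.prod_univ_sum, Fintype.piFinset_univ]
  have h2 : ∀ i, ∑ u : ℤˣ, Real.exp (((u : ℤ) : ℝ) * g i) ≤ 2 * Real.exp (C ^ 2 / 2) := by
    intro i
    have h3 : ∑ u : ℤˣ, Real.exp (((u : ℤ) : ℝ) * g i) = 2 * Real.cosh (g i) := by
      rw [Real.cosh_eq]
      simp
      ring
    rw [h3]
    have h4 : g i ^ 2 ≤ C ^ 2 := by
      rw [← sq_abs]; exact pow_le_pow_left₀ (abs_nonneg _) (hg i) 2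
    have h5 := (Real.cosh_le_exp_half_sq (g i)).trans
      (Real.exp_le_exp.2 (div_le_div_of_nonneg_right h4 zero_le_two))
    linarith
  rw [h1]
  calc _ ≤ ∏ _i : ι, 2 * Real.exp (C ^ 2 / 2) :=
        Finset.prod_le_prod (fun i _ => Finset.sum_nonneg fun _ _ => (Real.exp_pos _).le)
          fun i _ => h2 i
    _ = _ := by
        rw [Finset.prod_const, mul_pow, ← Real.exp_nat_mul, Finset.card_univ]

/-- The exponential moment method: a maximum is bounded through the sum of exponentials over all of
`Z`. The tangent `log u ≤ log B - 1 + u / B` replaces Jensen's inequality, with `B` the bound for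
the averaged sum. -/
theorem radSum_comp_le_of_pos {Z : Type*} [Fintype Z] [Nonempty Z] (code : T → Z)
    (g : ι → Z → ℝ) (C : ℝ) (hg : ∀ i z, |g i z| ≤ C) {s : ℝ} (hs : 0 < s) :
    s * radSum (fun i t => g i (code t)) ≤ 2 ^ Fintype.card ι *
      (Real.log (Fintype.card Z) + Fintype.card ι * ((s * C) ^ 2 / 2)) := by
  set n : ℝ := ((Fintype.card ι : ℕ) : ℝ) with hnd
  have hZ : (0 : ℝ) < Fintype.card Z := by exact_mod_cast Fintype.card_pos
  set B : ℝ := Fintype.card Z * Real.exp (n * ((s * C) ^ 2 / 2))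
  have hB : 0 < B := by positivity
  have hlog : Real.log B = Real.log (Fintype.card Z) + n * ((s * C) ^ 2 / 2) := by
    rw [Real.log_mul hZ.ne' (Real.exp_pos _).ne', Real.log_exp]
  rw [← hlog, ← radSum_const_mul hs.le]
  have hpt : ∀ (σ : ι → ℤˣ) (t : T), ∑ i, ((σ i : ℤ) : ℝ) * (s * g i (code t)) ≤
      Real.log B - 1 + (∑ z, Real.exp (∑ i, ((σ i : ℤ) : ℝ) * (s * g i z))) / B := by
    intro σ t
    set x := ∑ i, ((σ i : ℤ) : ℝ) * (s * g i (code t)) with hx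
    have h1 : Real.exp x ≤ ∑ z, Real.exp (∑ i, ((σ i : ℤ) : ℝ) * (s * g i z)) :=
      Finset.single_le_sum (f := fun z => Real.exp (∑ i, ((σ i : ℤ) : ℝ) * (s * g i z)))
        (fun z _ => (Real.exp_pos _).le) (Finset.mem_univ (code t))
    have h2 := Real.add_one_le_exp (x - Real.log B)
    rw [Real.exp_sub, Real.exp_log hB] at h2
    have h3 := div_le_div_of_nonneg_right h1 hB.le
    linarith
  refine (radSum_le_of_forall hpt).trans ?_
  rw [Finset.sum_add_distrib, ← Finset.sum_div, Finset.sum_comm]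
  have h4 : ∑ z : Z, ∑ σ : ι → ℤˣ, Real.exp (∑ i, ((σ i : ℤ) : ℝ) * (s * g i z)) ≤
      ∑ _z : Z, 2 ^ Fintype.card ι * Real.exp (n * ((s * C) ^ 2 / 2)) := by
    refine Finset.sum_le_sum fun z _ => sum_sign_exp_le _ _ fun i => ?_
    rw [abs_mul, abs_of_pos hs]
    exact mul_le_mul_of_nonneg_left (hg i z) hs.le
  have h5 : ∑ _z : Z, 2 ^ Fintype.card ι * Real.exp (n * ((s * C) ^ 2 / 2)) =
      2 ^ Fintype.card ι * B := by
    rw [Finset.sum_const, Finset.card_univ, nsmul_eq_mul]; ring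
  rw [h5, ← div_le_div_iff_of_pos_right hB, mul_div_cancel_right₀ _ hB.ne'] at h4
  have h6 : ∑ _σ : ι → ℤˣ, (Real.log B - 1) = 2 ^ Fintype.card ι * (Real.log B - 1) := by
    rw [Finset.sum_const, Finset.card_univ, nsmul_eq_mul]
    simp [Fintype.card_pi]
  rw [h6]
  linarith

/-- Massart's finite class lemma. -/
theorem radSum_comp_le {Z : Type*} [Fintype Z] [Nonempty Z] (code : T → Z) (g : ι → Z → ℝ)
    (C : ℝ) (hC : 0 ≤ C) (hg : ∀ i z, |g i z| ≤ C) (l : ℝ) (hl : Real.log (Fintype.card Z) ≤ l)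
    (hl0 : 0 < l) :
    radSum (fun i t => g i (code t)) ≤
      2 ^ Fintype.card ι * (C * √(2 * Fintype.card ι * l)) := by
  rcases isEmpty_or_nonempty ι with hι | hι
  · simp [radSum]
  rcases hC.eq_or_lt with rfl | hC
  · have : g = fun _ _ => 0 := by
      funext i z; exact abs_nonpos_iff.1 (hg i z)
    subst this
    simp [radSum_zero]
  have hn : (0 : ℝ) < Fintype.card ι := by exact_mod_cast Fintype.card_pos
  set n : ℝ := ((Fintype.card ι : ℕ) : ℝ) with hnd
  have hr : 0 < √(2 * n * l) := by positivity
  have hsq : √(2 * n * l) ^ 2 = 2 * n * l := Real.sq_sqrt (by positivity)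
  set r := √(2 * n * l)
  -- The optimal parameter: it makes the quadratic term equal to `l`.
  have hs : 0 < r / (n * C) := by positivity
  have h := radSum_comp_le_of_pos code g C hg hs
  refine le_of_mul_le_mul_left (h.trans ?_) hs
  have e1 : r / (n * C) * (2 ^ Fintype.card ι * (C * r)) = 2 ^ Fintype.card ι * (2 * l) := by
    field_simp
    linarith
  have e2 : n * ((r / (n * C) * C) ^ 2 / 2) = l := by
    field_simp
    linarith
  rw [e1, ← hnd, e2]
  gcongr
  linarith

end RadSum

/-! ### Nets, digital expansions and random signs of codes -/

section Codes

/-- A ball of radius `2` is covered by `5 ^ dim` balls of radius `1`. -/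
theorem exists_finset_cover_ball (V : Type*) [NormedAddCommGroup V] [NormedSpace ℝ V]
    [FiniteDimensional ℝ V] :
    ∃ S : Finset V, S.Nonempty ∧ S.card ≤ 5 ^ Module.finrank ℝ V ∧
      ∀ x : V, ‖x‖ ≤ 2 → ∃ c ∈ S, ‖x - c‖ ≤ 1 := by
  classical
  -- A 1-separated subset of the ball of largest cardinality is a net: an uncovered point could be
  -- added to it. The packing bound `5 ^ dim` makes the largest cardinality exist.
  let P : ℕ → Prop := fun k => ∃ S : Finset V, S.card = k ∧ (∀ c ∈ S, ‖c‖ ≤ 2) ∧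
    ∀ c ∈ S, ∀ d ∈ S, c ≠ d → 1 ≤ ‖c - d‖
  have hP0 : P 0 := ⟨∅, by simp⟩
  have hspec := Nat.findGreatest_spec (P := P) (Nat.zero_le (5 ^ Module.finrank ℝ V)) hP0
  obtain ⟨S, hS, hS2, hsep⟩ := hspec
  have hcov : ∀ x : V, ‖x‖ ≤ 2 → ∃ c ∈ S, ‖x - c‖ ≤ 1 := by
    intro x hx
    by_contra! hne
    have hxS : x ∉ S := fun h => by
      have := hne x h
      simp at this
      linarith
    have h2 : ∀ c ∈ insert x S, ‖c‖ ≤ 2 := by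
      simpa [hx] using hS2
    have hsep' : ∀ c ∈ insert x S, ∀ d ∈ insert x S, c ≠ d → 1 ≤ ‖c - d‖ := by
      intro c hc d hd hcd
      rcases Finset.mem_insert.1 hc with hcx | hc <;> rcases Finset.mem_insert.1 hd with hdx | hd
      · exact absurd (hcx.trans hdx.symm) hcd
      · rw [hcx]; exact (hne d hd).le
      · rw [hdx, norm_sub_rev]; exact (hne c hc).le
      · exact hsep c hc d hd hcd
    have hle := Nat.le_findGreatest (P := P)
      (Besicovitch.card_le_of_separated (insert x S) h2 hsep') ⟨insert x S, rfl, h2, hsep'⟩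
    rw [← hS, Finset.card_insert_of_notMem hxS] at hle
    omega
  refine ⟨S, ?_, ?_, hcov⟩
  · obtain ⟨c, hc, _⟩ := hcov 0 (by simp)
    exact ⟨c, hc⟩
  · rw [hS]; exact Nat.findGreatest_le _

/-- A bounded family of vectors has a digital expansion with at most `5 ^ dim` digits. -/
theorem exists_digits {V T : Type*} [NormedAddCommGroup V] [NormedSpace ℝ V]
    [FiniteDimensional ℝ V] (v : T → V) (ρ : ℝ) (hv : ∀ t, ‖v t‖ ≤ ρ) :
    ∃ (S : Finset V) (digit : ℕ → T → S), S.Nonempty ∧ S.card ≤ 5 ^ Module.finrank ℝ V ∧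
      ∀ l a a', (∀ j < l, digit j a = digit j a') → ‖v a - v a'‖ ≤ 2 * ρ * (1 / 2) ^ l := by
  obtain ⟨S, hSne, hcard, hcov⟩ := exists_finset_cover_ball V
  have hcov' : ∀ x : V, ∃ c : S, ‖x‖ ≤ 2 → ‖x - c‖ ≤ 1 := by
    intro x
    by_cases hx : ‖x‖ ≤ 2
    · obtain ⟨c, hc, h⟩ := hcov x hx
      exact ⟨⟨c, hc⟩, fun _ => h⟩
    · exact ⟨⟨_, hSne.choose_spec⟩, fun h => absurd h hx⟩
  choose c hc using hcov'
  -- Subtracting a digit leaves a remainder of norm at most 1; doubling returns it to the ball of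
  -- radius 2. Equal digits cancel, so each one halves the bound on the distance.
  let step : V → V := fun x => (2 : ℝ) • (x - (c x : V))
  have hstep : ∀ x, ‖x‖ ≤ 2 → ‖step x‖ ≤ 2 := by
    intro x hx
    rw [norm_smul]
    have := hc x hx
    norm_num
    linarith
  have hiter : ∀ j x, ‖x‖ ≤ 2 → ‖step^[j] x‖ ≤ 2 := by
    intro j
    induction j with
    | zero => simp
    | succ j ih => intro x hx; rw [Function.iterate_succ_apply]; exact ih _ (hstep x hx)
  have hdist : ∀ l x x', ‖x‖ ≤ 2 → ‖x'‖ ≤ 2 →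
      (∀ j < l, c (step^[j] x) = c (step^[j] x')) → ‖x - x'‖ ≤ 4 * (1 / 2) ^ l := by
    intro l
    induction l with
    | zero =>
      intro x x' hx hx' _
      have := norm_sub_le x x'
      norm_num
      linarith
    | succ l ih =>
      intro x x' hx hx' h
      have h0 := h 0 (Nat.succ_pos l)
      have h1 := ih (step x) (step x') (hstep x hx) (hstep x' hx') fun j hj => by
        have := h (j + 1) (by omega)
        simpa only [Function.iterate_succ_apply] using this
      have h2 : step x - step x' = (2 : ℝ) • (x - x') := by
        simp only [Function.iterate_zero, id] at h0
        simp only [step, h0, ← smul_sub]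
        congr 1
        abel
      rw [h2, norm_smul] at h1
      norm_num at h1 ⊢
      rw [pow_succ]
      linarith
  rcases isEmpty_or_nonempty T with hT | ⟨⟨t0⟩⟩
  · exact ⟨S, fun _ t => isEmptyElim t, hSne, hcard, fun _ a => isEmptyElim a⟩
  have hρ : 0 ≤ ρ := (norm_nonneg _).trans (hv t0)
  rcases hρ.eq_or_lt with rfl | hρ
  · refine ⟨S, fun _ _ => c 0, hSne, hcard, fun l a a' _ => ?_⟩
    have h0 : ∀ t, v t = 0 := fun t => norm_le_zero_iff.1 (hv t)
    simp [h0]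
  · have hsc : ∀ t, ‖(2 / ρ) • v t‖ ≤ 2 := by
      intro t
      rw [norm_smul, Real.norm_of_nonneg (by positivity), div_mul_eq_mul_div, div_le_iff₀ hρ]
      linarith [hv t]
    refine ⟨S, fun j t => c (step^[j] ((2 / ρ) • v t)), hSne, hcard, fun l a a' h => ?_⟩
    have h1 := hdist l _ _ (hsc a) (hsc a') h
    rw [← smul_sub, norm_smul, Real.norm_of_nonneg (by positivity), div_mul_eq_mul_div,
      div_le_iff₀ hρ] at h1
    linarith

/-- Multiscale bound of a distance by indicators of distinct codes. -/
theorem norm_sub_le_sum_indicator {V T S : Type*} [NormedAddCommGroup V] [DecidableEq S]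
    (v : T → V) (ρ : ℝ) (hρ : 0 ≤ ρ) (digit : ℕ → T → S)
    (h : ∀ l a a', (∀ j < l, digit j a = digit j a') → ‖v a - v a'‖ ≤ 2 * ρ * (1 / 2) ^ l)
    (L : ℕ) (a a' : T) :
    ‖v a - v a'‖ ≤ 2 * ρ * (1 / 2) ^ L + ∑ l : Fin L, 2 * ρ * (1 / 2) ^ (l : ℕ) *
      (if (fun j : Fin (l + 1) => digit j a) = (fun j : Fin (l + 1) => digit j a')
        then 0 else 1) := by
  have hterm : ∀ l : Fin L, 0 ≤ 2 * ρ * (1 / 2) ^ (l : ℕ) *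
      (if (fun j : Fin (l + 1) => digit j a) = (fun j : Fin (l + 1) => digit j a')
        then (0 : ℝ) else 1) := by
    intro l
    split_ifs <;> positivity
  by_cases hL : ∀ j < L, digit j a = digit j a'
  · exact (h L a a' hL).trans (le_add_of_nonneg_right (Finset.sum_nonneg fun l _ => hterm l))
  · have hex : ∃ j, digit j a ≠ digit j a' := by
      push Not at hL
      obtain ⟨j, _, hj⟩ := hL
      exact ⟨j, hj⟩
    have hfL : Nat.find hex < L := by
      push Not at hL
      obtain ⟨j, hjL, hj⟩ := hL
      exact (Nat.find_min' hex hj).trans_lt hjL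
    have h1 := h (Nat.find hex) a a' fun j hj => not_not.1 (Nat.find_min hex hj)
    have h2 := Finset.single_le_sum (fun l _ => hterm l) (Finset.mem_univ ⟨Nat.find hex, hfL⟩)
    have h3 : ¬ ((fun j : Fin (Nat.find hex + 1) => digit j a) =
        (fun j : Fin (Nat.find hex + 1) => digit j a')) := fun heq =>
      Nat.find_spec hex (congrFun heq (Fin.last (Nat.find hex)))
    simp only [h3, if_false, mul_one] at h2
    have : 0 ≤ 2 * ρ * (1 / 2) ^ L := by positivity
    linarith

/-- Random signs separate points with probability one half. -/
theorem sum_abs_sign_sub {Z : Type*} [Fintype Z] [DecidableEq Z] (z z' : Z) :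
    ∑ τ : Z → ℤˣ, |((τ z : ℤ) : ℝ) - ((τ z' : ℤ) : ℝ)| =
      2 ^ Fintype.card Z * (if z = z' then 0 else 1) := by
  split_ifs with h
  · simp [h]
  -- Flipping the sign at `z` exchanges the values 0 and 2 of the absolute difference.
  · have h1 := sum_flipSign z fun τ : Z → ℤˣ => |((τ z : ℤ) : ℝ) - ((τ z' : ℤ) : ℝ)|
    have h2 : ∀ τ : Z → ℤˣ, |((flipSign z τ z : ℤ) : ℝ) - ((flipSign z τ z' : ℤ) : ℝ)| +
        |((τ z : ℤ) : ℝ) - ((τ z' : ℤ) : ℝ)| = 2 := by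
      intro τ
      rw [flipSign, Function.update_self, Function.update_of_ne (Ne.symm h)]
      rcases Int.units_eq_one_or (τ z) with h3 | h3 <;>
        rcases Int.units_eq_one_or (τ z') with h4 | h4 <;> rw [h3, h4] <;> norm_num
    have h3 := Finset.sum_congr (rfl : (Finset.univ : Finset (Z → ℤˣ)) = Finset.univ)
      fun τ _ => h2 τ
    rw [Finset.sum_add_distrib, h1] at h3
    simp [Fintype.card_pi] at h3
    linarith

end Codes

/-! ### Random sign patterns detecting a difference of two coordinates -/

section Signs

variable {κ : Type*} [Fintype κ] [DecidableEq κ]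

/-- Resampling one coordinate preserves the uniform measure, because exchanging `ω k` with `t` is an
involution on pairs. -/
theorem sum_sum_update {A : Type*} [Fintype A] (F : (κ → A) → ℝ) (k : κ) :
    ∑ t : A, ∑ ω : κ → A, F (Function.update ω k t) = Fintype.card A * ∑ ω, F ω := by
  have hinv : Function.Involutive fun p : (κ → A) × A => (Function.update p.1 k p.2, p.1 k) := by
    rintro ⟨ω, t⟩
    simp
  have h := Equiv.sum_comp hinv.toPerm fun p : (κ → A) × A => F p.1
  simp only [Function.Involutive.coe_toPerm, Fintype.sum_prod_type] at h
  rw [Finset.sum_comm, h]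
  simp [Finset.mul_sum]

theorem sum_apply_eq {A : Type*} [Fintype A] [Nonempty A] (g : A → ℝ) (k : κ) :
    ∑ ω : κ → A, g (ω k) =
      (Fintype.card A : ℝ) ^ Fintype.card κ * ((∑ t, g t) / Fintype.card A) := by
  have h := sum_sum_update (fun ω : κ → A => g (ω k)) k
  simp only [Function.update_self, Finset.sum_const, nsmul_eq_mul, Finset.card_univ,
    Fintype.card_pi, Finset.prod_const, ← Finset.mul_sum] at h
  push_cast at h
  have hA : (Fintype.card A : ℝ) ≠ 0 := by exact_mod_cast Fintype.card_ne_zero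
  field_simp
  linarith

/-- Jensen's inequality for a sum of independent terms, in all but one of them. -/
theorem average_abs_sum_ge {A : Type*} [Fintype A] [Nonempty A] (s : κ → A → ℝ) (D : κ → ℝ)
    (k : κ) :
    (Fintype.card A : ℝ) ^ Fintype.card κ * (∑ t, |s k t * D k +
        ∑ j ∈ Finset.univ.erase k, (∑ u, s j u) / Fintype.card A * D j|) ≤
      Fintype.card A * ∑ ω : κ → A, |∑ j, s j (ω j) * D j| := by
  rw [← sum_sum_update (fun ω : κ → A => |∑ j, s j (ω j) * D j|) k, Finset.mul_sum]
  refine Finset.sum_le_sum fun t _ => ?_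
  refine le_trans (le_of_eq ?_) (Finset.abs_sum_le_sum_abs _ _)
  have h0 : 0 ≤ (Fintype.card A : ℝ) ^ Fintype.card κ := by positivity
  conv_lhs => rw [← abs_of_nonneg h0, ← abs_mul]
  congr 1
  have h1 : ∀ ω : κ → A, ∑ j, s j (Function.update ω k t j) * D j =
      s k t * D k + ∑ j ∈ Finset.univ.erase k, s j (ω j) * D j := by
    intro ω
    rw [← Finset.add_sum_erase _ _ (Finset.mem_univ k), Function.update_self]
    congr 1
    refine Finset.sum_congr rfl fun j hj => ?_
    rw [Function.update_of_ne (Finset.ne_of_mem_erase hj)]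
  simp only [h1, Finset.sum_add_distrib]
  rw [Finset.sum_comm (s := Finset.univ) (t := Finset.univ.erase k), mul_add, Finset.mul_sum]
  congr 1
  · simp [Fintype.card_pi]
  · refine Finset.sum_congr rfl fun j _ => ?_
    rw [← Finset.sum_mul, sum_apply_eq (s j) j]
    ring

/-- The coefficients of the three kinds of random sign vectors: the sign at the label is `1`, and
the other signs are fair, mostly `-1`, or `1`. -/
def signPattern (y : κ) (o : Fin 9) (k : κ) (u : Fin 4) : ℝ :=
  if k = y then 1
  else if o < 4 then ![1, 1, -1, -1] u
  else if o < 8 then ![-1, -1, -1, 1] u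
  else 1

theorem abs_signPattern_le (y : κ) (o : Fin 9) (k : κ) (u : Fin 4) :
    |signPattern y o k u| ≤ 1 := by
  unfold signPattern
  split_ifs <;> fin_cases u <;> simp

/-- The random sign vectors detect the difference of two coordinates, with a margin. -/
theorem five_abs_sub_le_average (D : κ → ℝ) (y k : κ) (hk : k ≠ y) :
    (4 : ℝ) ^ Fintype.card κ * (5 * |D y - D k|) ≤
      ∑ o : Fin 9, ∑ ω : κ → Fin 4, |∑ j, signPattern y o j (ω j) * D j| := by
  have hy : y ∈ Finset.univ.erase k := Finset.mem_erase.2 ⟨hk.symm, Finset.mem_univ y⟩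
  have h := fun o => average_abs_sum_ge (signPattern y o) D k
  simp only [Fintype.card_fin] at h
  set S := ∑ j ∈ (Finset.univ.erase k).erase y, D j with hS
  have e : ∀ (o : Fin 9) (c : ℝ), (∀ j, j ≠ y → (∑ u, signPattern y o j u) / ((4 : ℕ) : ℝ) = c) →
      ∑ j ∈ Finset.univ.erase k, (∑ u, signPattern y o j u) / ((4 : ℕ) : ℝ) * D j =
        D y + c * S := by
    intro o c hc
    rw [← Finset.add_sum_erase _ _ hy, hS, Finset.mul_sum]
    congr 1
    · simp [signPattern]
    · refine Finset.sum_congr rfl fun j hj => ?_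
      rw [hc j (Finset.ne_of_mem_erase hj)]
  have e1 : ∀ o : Fin 9, o < 4 →
      ∑ j ∈ Finset.univ.erase k, (∑ u, signPattern y o j u) / ((4 : ℕ) : ℝ) * D j =
        D y + 0 * S := fun o ho => e o 0 fun j hj => by
    simp [signPattern, hj, ho, Fin.sum_univ_four]
  have e2 : ∀ o : Fin 9, ¬ o < 4 → o < 8 →
      ∑ j ∈ Finset.univ.erase k, (∑ u, signPattern y o j u) / ((4 : ℕ) : ℝ) * D j =
        D y + -(1 / 2) * S := fun o ho ho' => e o _ fun j hj => by
    simp only [signPattern, hj, ho, ho', Fin.sum_univ_four, if_true, if_false, Matrix.cons_val]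
    norm_num
  have e3 : ∀ o : Fin 9, ¬ o < 4 → ¬ o < 8 →
      ∑ j ∈ Finset.univ.erase k, (∑ u, signPattern y o j u) / ((4 : ℕ) : ℝ) * D j =
        D y + 1 * S := fun o ho ho' => e o _ fun j hj => by
    simp [signPattern, hj, ho, ho']
  have k1 : ∀ o : Fin 9, o < 4 → (4 : ℝ) ^ Fintype.card κ *
      (2 * |D k + D y| + 2 * |D y - D k|) ≤
        4 * ∑ ω : κ → Fin 4, |∑ j, signPattern y o j (ω j) * D j| := by
    intro o ho
    have := h o
    rw [e1 o ho] at this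
    refine le_trans (le_of_eq ?_) this
    simp [Fin.sum_univ_four, signPattern, hk, ho, neg_add_eq_sub]
    ring
  have k2 : ∀ o : Fin 9, ¬ o < 4 → o < 8 → (4 : ℝ) ^ Fintype.card κ *
      (3 * |D y - D k - S / 2| + |D y + D k - S / 2|) ≤
        4 * ∑ ω : κ → Fin 4, |∑ j, signPattern y o j (ω j) * D j| := by
    intro o ho ho'
    have := h o
    rw [e2 o ho ho'] at this
    refine le_trans (le_of_eq ?_) this
    have r1 : -1 * D k + (D y + -(1 / 2) * S) = D y - D k - S / 2 := by ring
    have r2 : 1 * D k + (D y + -(1 / 2) * S) = D y + D k - S / 2 := by ring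
    simp only [Fin.sum_univ_four, signPattern, hk, ho, ho', if_true, if_false]
    simp only [Matrix.cons_val, r1, r2]
    push_cast
    ring
  have k3 : ∀ o : Fin 9, ¬ o < 4 → ¬ o < 8 → (4 : ℝ) ^ Fintype.card κ *
      (4 * |D y + D k + S|) ≤
        4 * ∑ ω : κ → Fin 4, |∑ j, signPattern y o j (ω j) * D j| := by
    intro o ho ho'
    have := h o
    rw [e3 o ho ho'] at this
    refine le_trans (le_of_eq ?_) this
    have r1 : 1 * D k + (D y + 1 * S) = D y + D k + S := by ring
    simp only [Fin.sum_univ_four, signPattern, hk, ho, ho', if_false, r1]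
    push_cast
    ring
  -- The proportions 4 : 4 : 1 make the other quantities cancel: by the triangle inequalities below,
  -- `|D y + D k|` has total coefficient `8 - 4 - 4` and `|S|` has `-6 + 2 + 4`.
  have key : 20 * |D y - D k| ≤ 4 * (2 * |D k + D y| + 2 * |D y - D k|) +
      4 * (3 * |D y - D k - S / 2| + |D y + D k - S / 2|) + 4 * |D y + D k + S| := by
    rw [add_comm (D k) (D y)]
    have a1 : |S| / 2 - |D y + D k| ≤ |D y + D k - S / 2| := by
      have := abs_sub_abs_le_abs_sub (S / 2) (D y + D k)
      rw [abs_sub_comm, abs_div, abs_two] at this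
      linarith
    have a2 : |S| - |D y + D k| ≤ |D y + D k + S| := by
      have := abs_sub_abs_le_abs_sub S (-(D y + D k))
      rw [abs_neg, sub_neg_eq_add, add_comm S] at this
      linarith
    have a3 : |D y - D k| - |S| / 2 ≤ |D y - D k - S / 2| := by
      have := abs_sub_abs_le_abs_sub (D y - D k) (S / 2)
      rw [abs_div, abs_two] at this
      linarith
    linarith
  have hp : (0 : ℝ) ≤ 4 ^ Fintype.card κ := by positivity
  have key' := mul_le_mul_of_nonneg_left key hp
  have hsum : ∀ g : Fin 9 → ℝ, ∑ o, g o =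
      g 0 + g 1 + g 2 + g 3 + g 4 + g 5 + g 6 + g 7 + g 8 := fun g => by
    simp [Fin.sum_univ_succ]; ring
  rw [hsum]
  have q0 := k1 0 (by decide)
  have q1 := k1 1 (by decide)
  have q2 := k1 2 (by decide)
  have q3 := k1 3 (by decide)
  have q4 := k2 4 (by decide) (by decide)
  have q5 := k2 5 (by decide) (by decide)
  have q6 := k2 6 (by decide) (by decide)
  have q7 := k2 7 (by decide) (by decide)
  have q8 := k3 8 (by decide) (by decide)
  linarith

end Signs

/-! ### `ℓ_r` norms and a doubly stochastic Hölder inequality -/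

section LpNorm

variable {n : ℕ}

theorem lpNorm_nonneg {r : ℝ≥0∞} (hr : 1 ≤ r) (v : Fin n → ℝ) : 0 ≤ lpNorm r v := by
  have : Fact (1 ≤ r) := ⟨hr⟩
  exact norm_nonneg _

theorem abs_le_lpNorm {r : ℝ≥0∞} (hr : 1 ≤ r) (v : Fin n → ℝ) (i : Fin n) :
    |v i| ≤ lpNorm r v := by
  have : Fact (1 ≤ r) := ⟨hr⟩
  exact PiLp.norm_apply_le (WithLp.toLp r v : PiLp r (fun _ : Fin n => ℝ)) i

theorem lpNorm_le_sum {r : ℝ≥0∞} (hr : 1 ≤ r) (v : Fin n → ℝ) : lpNorm r v ≤ ∑ i, |v i| := by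
  have : Fact (1 ≤ r) := ⟨hr⟩
  have h : (WithLp.toLp r v : PiLp r (fun _ : Fin n => ℝ)) =
      ∑ i, PiLp.single r i (v i) := by
    ext j
    simp
  rw [lpNorm, h]
  refine (norm_sum_le _ _).trans (Finset.sum_le_sum fun i _ => ?_)
  rw [PiLp.norm_single, Real.norm_eq_abs]

theorem lpNorm_zero {r : ℝ≥0∞} (hr : 1 ≤ r) : lpNorm r (0 : Fin n → ℝ) = 0 :=
  le_antisymm ((lpNorm_le_sum hr _).trans (by simp)) (lpNorm_nonneg hr _)

theorem lpNorm_one (v : Fin n → ℝ) : lpNorm 1 v = ∑ i, |v i| := by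
  rw [lpNorm, PiLp.norm_eq_sum (by simp)]
  simp

theorem lpNorm_of_toReal_pos {r : ℝ≥0∞} (hr : 0 < r.toReal) (v : Fin n → ℝ) :
    lpNorm r v = (∑ i, |v i| ^ r.toReal) ^ (1 / r.toReal) := by
  rw [lpNorm, PiLp.norm_eq_sum hr]
  rfl

theorem lpNorm_abs {r : ℝ≥0∞} (hr : 1 ≤ r) (v : Fin n → ℝ) :
    lpNorm r (fun i => |v i|) = lpNorm r v := by
  rcases eq_or_ne r ∞ with rfl | hr'
  · rw [lpNorm, lpNorm, PiLp.norm_eq_ciSup, PiLp.norm_eq_ciSup]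
    simp
  · have hpos : 0 < r.toReal := ENNReal.toReal_pos (zero_lt_one.trans_le hr).ne' hr'
    rw [lpNorm_of_toReal_pos hpos, lpNorm_of_toReal_pos hpos]
    simp

/-- Eigenvalues will be compared as roots of a characteristic polynomial, hence only as multisets.
-/
theorem lpNorm_congr {r : ℝ≥0∞} (hr : 1 ≤ r) {v w : Fin n → ℝ}
    (h : Multiset.map v Finset.univ.val = Multiset.map w Finset.univ.val) :
    lpNorm r v = lpNorm r w := by
  rcases eq_or_ne r ∞ with rfl | hr'
  · have hrange : Set.range v = Set.range w := by
      ext x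
      have : x ∈ Multiset.map v Finset.univ.val ↔ x ∈ Multiset.map w Finset.univ.val := by rw [h]
      simpa using this
    rw [lpNorm, lpNorm, PiLp.norm_eq_ciSup, PiLp.norm_eq_ciSup, iSup, iSup]
    congr 1
    have e : ∀ u : Fin n → ℝ, (Set.range fun i => ‖u i‖) = norm '' Set.range u := fun u =>
      Set.range_comp norm u
    exact (e v).trans ((congrArg _ hrange).trans (e w).symm)
  · have hpos : 0 < r.toReal := ENNReal.toReal_pos (zero_lt_one.trans_le hr).ne' hr'
    rw [lpNorm_of_toReal_pos hpos, lpNorm_of_toReal_pos hpos]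
    congr 1
    have := congrArg (fun s => (Multiset.map (fun x : ℝ => |x| ^ r.toReal) s).sum) h
    simp only [Multiset.map_map] at this
    exact this

/-- Hölder's inequality with doubly stochastic weights. -/
theorem abs_sum_sum_mul_le {r : ℝ≥0∞} (hr : 1 ≤ r) (P : Fin n → Fin n → ℝ)
    (hP : ∀ i j, 0 ≤ P i j) (hrow : ∀ i, ∑ j, P i j = 1) (hcol : ∀ j, ∑ i, P i j = 1)
    (a b : Fin n → ℝ) :
    |∑ i, ∑ j, P i j * (a i * b j)| ≤ lpNorm r a * lpNorm (ENNReal.conjExponent r) b := by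
  have h0 : |∑ i, ∑ j, P i j * (a i * b j)| ≤ ∑ i, ∑ j, P i j * (|a i| * |b j|) := by
    refine (Finset.abs_sum_le_sum_abs _ _).trans (Finset.sum_le_sum fun i _ => ?_)
    refine (Finset.abs_sum_le_sum_abs _ _).trans (Finset.sum_le_sum fun j _ => ?_)
    rw [abs_mul, abs_mul, abs_of_nonneg (hP i j)]
  refine h0.trans ?_
  have hc : 1 ≤ ENNReal.conjExponent r := by simp [ENNReal.conjExponent]
  rcases eq_or_ne r 1 with rfl | hr1
  · rw [lpNorm_one, Finset.sum_mul]
    refine Finset.sum_le_sum fun i _ => ?_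
    calc _ ≤ ∑ j, P i j * (|a i| * lpNorm (ENNReal.conjExponent 1) b) :=
          Finset.sum_le_sum fun j _ => by
            have := abs_le_lpNorm hc b j
            have := hP i j
            gcongr
      _ = _ := by rw [← Finset.sum_mul, hrow, one_mul]
  rcases eq_or_ne r ∞ with rfl | hrt
  · have hone : ENNReal.conjExponent ∞ = 1 := by simp [ENNReal.conjExponent]
    rw [hone, lpNorm_one, Finset.mul_sum, Finset.sum_comm]
    refine Finset.sum_le_sum fun j _ => ?_
    calc _ ≤ ∑ i, P i j * (lpNorm ∞ a * |b j|) :=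
          Finset.sum_le_sum fun i _ => by
            have := abs_le_lpNorm le_top a i
            have := hP i j
            gcongr
      _ = _ := by rw [← Finset.sum_mul, hcol, one_mul]
  · have := ENNReal.HolderConjugate.conjExponent hr
    have h1 : 1 < r.toReal := by
      rw [← ENNReal.toReal_one]
      exact (ENNReal.toReal_lt_toReal ENNReal.one_ne_top hrt).2 (lt_of_le_of_ne hr hr1.symm)
    have hpq := ENNReal.HolderConjugate.toReal (p := r) (q := ENNReal.conjExponent r) h1
    rw [lpNorm_of_toReal_pos hpq.pos, lpNorm_of_toReal_pos hpq.symm.pos]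
    set p := r.toReal
    set q := (ENNReal.conjExponent r).toReal
    -- The weight is split as `P = P ^ (1/p) * P ^ (1/q)`; after taking powers, row sums collapse
    -- one factor and column sums the other.
    have hH := Real.inner_le_Lp_mul_Lq (Finset.univ : Finset (Fin n × Fin n))
      (fun x => P x.1 x.2 ^ (1 / p) * |a x.1|) (fun x => P x.1 x.2 ^ (1 / q) * |b x.2|) hpq
    have hs : 1 / p + 1 / q = 1 := by
      simpa using hpq.inv_add_inv_eq_one
    have el : ∀ i j, P i j ^ (1 / p) * |a i| * (P i j ^ (1 / q) * |b j|) =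
        P i j * (|a i| * |b j|) := by
      intro i j
      have : P i j ^ (1 / p) * P i j ^ (1 / q) = P i j := by
        rw [← Real.rpow_add_of_nonneg (hP i j) (by have := hpq.pos; positivity)
          (by have := hpq.symm.pos; positivity), hs, Real.rpow_one]
      linear_combination (|a i| * |b j|) * this
    have ep : ∀ (s : ℝ), 0 < s → ∀ i j (x : ℝ), |P i j ^ (1 / s) * (|x|)| ^ s = P i j * |x| ^ s := by
      intro s hs i j x
      have h2 : 0 ≤ P i j ^ (1 / s) := Real.rpow_nonneg (hP i j) _
      rw [abs_mul, abs_abs, abs_of_nonneg h2, Real.mul_rpow h2 (abs_nonneg _), ← Real.rpow_mul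
        (hP i j), one_div_mul_cancel hs.ne', Real.rpow_one]
    simp only [ep p hpq.pos, ep q hpq.symm.pos, el, Fintype.sum_prod_type] at hH
    have e1 : ∑ i, ∑ j, P i j * |a i| ^ p = ∑ i, |a i| ^ p :=
      Finset.sum_congr rfl fun i _ => by rw [← Finset.sum_mul, hrow, one_mul]
    have e2 : ∑ i, ∑ j, P i j * |b j| ^ q = ∑ j, |b j| ^ q := by
      rw [Finset.sum_comm]
      exact Finset.sum_congr rfl fun j _ => by rw [← Finset.sum_mul, hcol, one_mul]
    rwa [e1, e2] at hH

end LpNorm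

/-! ### Schatten norms, traces of products and density matrices -/

section Schatten

open Matrix

variable {n : ℕ}

/-- The singular values of a Hermitian matrix are the absolute values of its eigenvalues. -/
theorem schattenNorm_of_isHermitian {r : ℝ≥0∞} (hr : 1 ≤ r) {A : Matrix (Fin n) (Fin n) ℂ}
    (hA : A.IsHermitian) : schattenNorm r A = lpNorm r hA.eigenvalues := by
  have hB := Matrix.isHermitian_conjTranspose_mul_self A
  have hchar : (Aᴴ * A).charpoly =
      ∏ i, (Polynomial.X - Polynomial.C ((hA.eigenvalues i ^ 2 : ℝ) : ℂ)) := by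
    have hAs := hA.spectral_theorem
    rw [Unitary.conjStarAlgAut_apply] at hAs
    set U := (hA.eigenvectorUnitary : Matrix (Fin n) (Fin n) ℂ)
    set Λ := diagonal (RCLike.ofReal ∘ hA.eigenvalues : Fin n → ℂ)
    have hU : star U * U = 1 := Unitary.coe_star_mul_self _
    have h1 : Aᴴ * A = U * (Λ * Λ) * star U := by
      rw [hA.eq]
      conv_lhs => rw [hAs]
      calc U * Λ * star U * (U * Λ * star U) = U * Λ * (star U * U) * Λ * star U := by
            simp only [Matrix.mul_assoc]
        _ = _ := by rw [hU]; simp only [Matrix.mul_assoc, Matrix.one_mul]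
    rw [h1, charpoly_mul_comm, ← Matrix.mul_assoc, hU, Matrix.one_mul, diagonal_mul_diagonal,
      charpoly_diagonal]
    refine Finset.prod_congr rfl fun i _ => ?_
    simp [sq]
  have hms : Multiset.map hB.eigenvalues Finset.univ.val =
      Multiset.map (fun i => hA.eigenvalues i ^ 2) Finset.univ.val := by
    have h1 := hB.roots_charpoly_eq_eigenvalues
    have h2 : (∏ i, (Polynomial.X - Polynomial.C ((hA.eigenvalues i ^ 2 : ℝ) : ℂ))).roots =
        Multiset.map (fun i => ((hA.eigenvalues i ^ 2 : ℝ) : ℂ)) Finset.univ.val := by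
      have := Polynomial.roots_multiset_prod_X_sub_C
        (Multiset.map (fun i => ((hA.eigenvalues i ^ 2 : ℝ) : ℂ)) Finset.univ.val)
      rwa [Multiset.map_map] at this
    rw [hchar, h2] at h1
    have h3 := congrArg (Multiset.map Complex.re) h1
    simp only [Multiset.map_map, Function.comp_def, Complex.ofReal_re, Complex.coe_algebraMap]
      at h3
    exact h3.symm
  have hms' := congrArg (Multiset.map Real.sqrt) hms
  simp only [Multiset.map_map, Function.comp_def, Real.sqrt_sq_eq_abs] at hms'
  exact (lpNorm_congr hr (w := fun i => |hA.eigenvalues i|) hms').trans (lpNorm_abs hr _)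

/-- The trace of a product of Hermitian matrices is an average of products of eigenvalues with
doubly stochastic weights. -/
theorem exists_score_eq_sum {A B : Matrix (Fin n) (Fin n) ℂ} (hA : A.IsHermitian)
    (hB : B.IsHermitian) :
    ∃ P : Fin n → Fin n → ℝ, (∀ i j, 0 ≤ P i j) ∧ (∀ i, ∑ j, P i j = 1) ∧
      (∀ j, ∑ i, P i j = 1) ∧
      score A B = ∑ i, ∑ j, P i j * (hA.eigenvalues i * hB.eigenvalues j) := by
  have hAs := hA.spectral_theorem
  have hBs := hB.spectral_theorem
  rw [Unitary.conjStarAlgAut_apply] at hAs hBs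
  set U := (hA.eigenvectorUnitary : Matrix (Fin n) (Fin n) ℂ)
  set W := (hB.eigenvectorUnitary : Matrix (Fin n) (Fin n) ℂ)
  set Λ := diagonal (RCLike.ofReal ∘ hA.eigenvalues : Fin n → ℂ) with hΛ
  set M := diagonal (RCLike.ofReal ∘ hB.eigenvalues : Fin n → ℂ) with hM
  have hU : star U * U = 1 := Unitary.coe_star_mul_self _
  have hU' : U * star U = 1 := Unitary.coe_mul_star_self _
  have hW : star W * W = 1 := Unitary.coe_star_mul_self _
  have hW' : W * star W = 1 := Unitary.coe_mul_star_self _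
  -- The transition matrix between the two eigenbases. Being unitary, it has doubly stochastic
  -- squared moduli, and these are the weights.
  set V := star U * W with hV
  have hVs : star V = star W * U := by rw [hV, star_mul, star_star]
  have hV1 : V * star V = 1 := by
    rw [hVs, hV]
    calc star U * W * (star W * U) = star U * (W * star W) * U := by simp only [Matrix.mul_assoc]
      _ = 1 := by rw [hW', Matrix.mul_one, hU]
  have hV2 : star V * V = 1 := by
    rw [hVs, hV]
    calc star W * U * (star U * W) = star W * (U * star U) * W := by simp only [Matrix.mul_assoc]
      _ = 1 := by rw [hU', Matrix.mul_one, hW]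
  have habs : ∀ i j, V i j * star (V i j) = ((Complex.normSq (V i j) : ℝ) : ℂ) := fun i j =>
    Complex.mul_conj _
  refine ⟨fun i j => Complex.normSq (V i j), fun i j => Complex.normSq_nonneg _, fun i => ?_,
    fun j => ?_, ?_⟩
  · have := congrFun (congrFun hV1 i) i
    rw [mul_apply, one_apply_eq] at this
    simp only [star_apply, habs] at this
    exact_mod_cast this
  · have := congrFun (congrFun hV2 j) j
    rw [mul_apply, one_apply_eq] at this
    simp only [star_apply, mul_comm (star _), habs] at this
    exact_mod_cast this
  · have h1 : (A * B).trace = (Λ * V * (M * star V)).trace := by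
      conv_lhs => rw [hAs, hBs]
      rw [hVs, hV]
      calc (U * Λ * star U * (W * M * star W)).trace
          = (U * (Λ * star U * (W * M * star W))).trace := by simp only [Matrix.mul_assoc]
        _ = _ := by rw [trace_mul_comm]; simp only [Matrix.mul_assoc]
    have h2 : (Λ * V * (M * star V)).trace = ((∑ i, ∑ j, Complex.normSq (V i j) *
        (hA.eigenvalues i * hB.eigenvalues j) : ℝ) : ℂ) := by
      push_cast
      refine Finset.sum_congr rfl fun i _ => ?_
      rw [diag_apply, mul_apply]
      refine Finset.sum_congr rfl fun j _ => ?_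
      rw [← habs, hΛ, hM, diagonal_mul, diagonal_mul, star_apply]
      simp only [Function.comp_apply, Complex.coe_algebraMap]
      ring
    rw [score, h1, h2, Complex.ofReal_re]

/-- Hölder's inequality for Schatten norms of Hermitian matrices. -/
theorem abs_score_le {r : ℝ≥0∞} (hr : 1 ≤ r) {A B : Matrix (Fin n) (Fin n) ℂ}
    (hA : A.IsHermitian) (hB : B.IsHermitian) :
    |score A B| ≤ schattenNorm r A * schattenNorm (ENNReal.conjExponent r) B := by
  obtain ⟨P, hP, hrow, hcol, h⟩ := exists_score_eq_sum hA hB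
  rw [h, schattenNorm_of_isHermitian hr hA,
    schattenNorm_of_isHermitian (by simp [ENNReal.conjExponent]) hB]
  exact abs_sum_sum_mul_le hr P hP hrow hcol _ _

theorem schattenNorm_nonneg {r : ℝ≥0∞} (hr : 1 ≤ r) (A : Matrix (Fin n) (Fin n) ℂ) :
    0 ≤ schattenNorm r A := lpNorm_nonneg hr _

theorem schattenNorm_zero {r : ℝ≥0∞} (hr : 1 ≤ r) :
    schattenNorm r (0 : Matrix (Fin n) (Fin n) ℂ) = 0 := by
  have h0 : (0 : Matrix (Fin n) (Fin n) ℂ).IsHermitian := isHermitian_zero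
  rw [schattenNorm_of_isHermitian hr h0, h0.eigenvalues_eq_zero_iff.2 rfl, lpNorm_zero hr]

theorem score_sub_right (A B C : Matrix (Fin n) (Fin n) ℂ) :
    score A (B - C) = score A B - score A C := by
  simp [score, Matrix.mul_sub]

theorem score_sub_left (A B C : Matrix (Fin n) (Fin n) ℂ) :
    score (A - B) C = score A C - score B C := by
  simp [score, Matrix.sub_mul]

theorem IsDensity.sum_eigenvalues {ρ : Matrix (Fin n) (Fin n) ℂ} (h : IsDensity ρ) :
    ∑ i, h.1.isHermitian.eigenvalues i = 1 := by
  have := h.1.isHermitian.trace_eq_sum_eigenvalues.symm.trans h.2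
  exact Complex.ofReal_injective (by push_cast; exact this)

theorem IsDensity.score_mem {ρ ρ' : Matrix (Fin n) (Fin n) ℂ} (h : IsDensity ρ)
    (h' : IsDensity ρ') : 0 ≤ score ρ ρ' ∧ score ρ ρ' ≤ 1 := by
  obtain ⟨P, hP, hrow, hcol, hs⟩ := exists_score_eq_sum h.1.isHermitian h'.1.isHermitian
  have h1 := h.1.eigenvalues_nonneg
  have h2 := h'.1.eigenvalues_nonneg
  rw [hs]
  refine ⟨Finset.sum_nonneg fun i _ => Finset.sum_nonneg fun j _ =>
    mul_nonneg (hP i j) (mul_nonneg (h1 i) (h2 j)), ?_⟩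
  calc _ ≤ ∑ i, ∑ j, h.1.isHermitian.eigenvalues i * h'.1.isHermitian.eigenvalues j := by
        refine Finset.sum_le_sum fun i _ => Finset.sum_le_sum fun j _ => ?_
        refine mul_le_of_le_one_left (mul_nonneg (h1 i) (h2 j)) ?_
        rw [← hrow i]
        exact Finset.single_le_sum (fun j _ => hP i j) (Finset.mem_univ j)
    _ = 1 := by
        simp only [← Finset.mul_sum, h'.sum_eigenvalues, mul_one, h.sum_eigenvalues]

theorem sum_singularValue_sq (A : Matrix (Fin n) (Fin n) ℂ) :
    ∑ i, singularValue A i ^ 2 = score Aᴴ A := by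
  have h := (isHermitian_conjTranspose_mul_self A).trace_eq_sum_eigenvalues
  have hnn := (posSemidef_conjTranspose_mul_self A).eigenvalues_nonneg
  rw [score, h]
  simp only [singularValue]
  rw [Complex.re_sum]
  refine Finset.sum_congr rfl fun i _ => ?_
  rw [Real.sq_sqrt (hnn i)]
  simp

/-- A crude bound, enough to make the supremum in `excess` one of a bounded set. The squared
singular values add up to `Tr (ρ - ρ')² ≤ 2`, so each singular value is at most 2. -/
theorem schattenNorm_sub_le {r : ℝ≥0∞} (hr : 1 ≤ r) {ρ ρ' : Matrix (Fin n) (Fin n) ℂ}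
    (h : IsDensity ρ) (h' : IsDensity ρ') : schattenNorm r (ρ - ρ') ≤ 2 * n := by
  have hsq := sum_singularValue_sq (ρ - ρ')
  rw [(h.1.isHermitian.sub h'.1.isHermitian).eq, score_sub_left, score_sub_right,
    score_sub_right] at hsq
  have hle : ∀ i, |singularValue (ρ - ρ') i| ≤ 2 := by
    intro i
    have h1 := Finset.single_le_sum (f := fun i => singularValue (ρ - ρ') i ^ 2)
      (fun i _ => sq_nonneg _) (Finset.mem_univ i)
    have h2 := (h.score_mem h).2
    have h3 := (h.score_mem h').1
    have h4 := (h'.score_mem h).1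
    have h5 := (h'.score_mem h').2
    refine abs_le_of_sq_le_sq (by linarith) zero_le_two
  refine (lpNorm_le_sum hr _).trans ((Finset.sum_le_sum fun i _ => hle i).trans ?_)
  simp [mul_comm]

theorem schattenNorm_density_le {r : ℝ≥0∞} (hr : 1 ≤ r) {ρ : Matrix (Fin n) (Fin n) ℂ}
    (h : IsDensity ρ) : schattenNorm r ρ ≤ n := by
  have hsq := sum_singularValue_sq ρ
  rw [h.1.isHermitian.eq] at hsq
  have hle : ∀ i, |singularValue ρ i| ≤ 1 := by
    intro i
    have h1 := Finset.single_le_sum (f := fun i => singularValue ρ i ^ 2)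
      (fun i _ => sq_nonneg _) (Finset.mem_univ i)
    have h2 := (h.score_mem h).2
    refine abs_le_of_sq_le_sq (by linarith) zero_le_one
  refine (lpNorm_le_sum hr _).trans ((Finset.sum_le_sum fun i _ => hle i).trans ?_)
  simp

end Schatten

/-! ### Chaining with a total weight of one -/

section Chaining

variable {ι κ T V : Type*} [Fintype ι] [DecidableEq ι] [Fintype κ] [DecidableEq κ] [Fintype T]
  [Nonempty T] [NormedAddCommGroup V] [NormedSpace ℝ V] [FiniteDimensional ℝ V]

theorem sum_three_quarters_pow_le (L : ℕ) : ∑ l : Fin L, ((3 : ℝ) / 4) ^ (l : ℕ) ≤ 4 := by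
  rw [Fin.sum_univ_eq_sum_range fun l => ((3 : ℝ) / 4) ^ l, geom_sum_eq (by norm_num)]
  have h : (0 : ℝ) ≤ (3 / 4) ^ L := by positivity
  rw [div_le_iff_of_neg (by norm_num)]
  linarith

theorem sum_succ_mul_two_thirds_pow_le (L : ℕ) :
    ∑ l : Fin L, ((l : ℕ) + 1 : ℝ) * (2 / 3) ^ (l : ℕ) ≤ 9 := by
  rw [Fin.sum_univ_eq_sum_range fun l => ((l : ℝ) + 1) * (2 / 3) ^ l]
  have h : ∀ L : ℕ, ∑ l ∈ Finset.range L, ((l : ℝ) + 1) * (2 / 3) ^ l =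
      9 - (3 * L + 9) * (2 / 3) ^ L := by
    intro L
    induction L with
    | zero => norm_num
    | succ L ih => rw [Finset.sum_range_succ, ih, pow_succ]; push_cast; ring
  rw [h]
  have : (0 : ℝ) ≤ (3 * L + 9) * (2 / 3) ^ L := by positivity
  linarith

theorem log_five_le_two : Real.log 5 ≤ 2 := by
  rw [Real.log_le_iff_le_exp (by norm_num)]
  have h := Real.exp_one_gt_d9
  have h2 : Real.exp 2 = Real.exp 1 * Real.exp 1 := by rw [← Real.exp_add]; norm_num
  rw [h2]
  nlinarith

theorem log_card_codes_le {S : Finset V} (hS : S.Nonempty)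
    (hcard : S.card ≤ 5 ^ Module.finrank ℝ V) {D : ℕ} (hD : Module.finrank ℝ V ≤ D) (l : ℕ) :
    Real.log (Fintype.card (Fin (l + 1) → S)) ≤ 2 * ((l + 1) * D) := by
  have h1 : (0 : ℝ) < S.card := by exact_mod_cast hS.card_pos
  have h2 : Real.log S.card ≤ D * 2 := by
    calc Real.log S.card ≤ Real.log (5 ^ D) := by
          refine Real.log_le_log h1 ?_
          exact_mod_cast hcard.trans (pow_le_pow_right₀ (by norm_num) hD)
      _ ≤ _ := by
          rw [Real.log_pow]
          exact mul_le_mul_of_nonneg_left log_five_le_two (Nat.cast_nonneg D)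
  simp only [Fintype.card_pi, Fintype.card_coe, Finset.prod_const, Finset.card_univ,
    Fintype.card_fin]
  push_cast
  rw [Real.log_pow]
  push_cast
  have := mul_le_mul_of_nonneg_left h2 (by positivity : (0 : ℝ) ≤ l + 1)
  linarith

/-- The functions whose increments dominate, on average, those of a Lipschitz function: signed sums
of the score functions, and random signs of the codes at all scales. -/
def dominant (f : κ → ι → T → ℝ) (y : ι → κ) {S : Type*} (digit : ℕ → T → S) (ρ : ℝ) {L : ℕ}
    (i : ι) : (Fin 9 × (κ → Fin 4)) ⊕ (Σ l : Fin L, (Fin (l + 1) → S) → ℤˣ) → T → ℝ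
  | .inl p => fun t => 2 * ∑ j, signPattern (y i) p.1 j (p.2 j) * f j i t
  | .inr p => fun t => 160 * ρ * (2 / 3) ^ (p.1 : ℕ) * (p.2 fun j => digit j t : ℤˣ)

/-- The weights of the dominating functions. -/
def dominantWeight (κ : Type*) [Fintype κ] (S : Type*) [Fintype S] {L : ℕ} :
    (Fin 9 × (κ → Fin 4)) ⊕ (Σ l : Fin L, (Fin (l + 1) → S) → ℤˣ) → ℝ
  | .inl _ => 1 / (10 * 4 ^ Fintype.card κ)
  | .inr p => 1 / 40 * (3 / 4) ^ (p.1 : ℕ) / 2 ^ Fintype.card (Fin (p.1 + 1) → S)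

theorem dominantWeight_nonneg {S : Type*} [Fintype S] {L : ℕ}
    (ω : (Fin 9 × (κ → Fin 4)) ⊕ (Σ l : Fin L, (Fin (l + 1) → S) → ℤˣ)) :
    0 ≤ dominantWeight κ S ω := by
  rcases ω with p | p <;> simp only [dominantWeight] <;> positivity

theorem sum_dominantWeight_le {S : Type*} [Fintype S] [DecidableEq S] {L : ℕ} :
    ∑ ω : (Fin 9 × (κ → Fin 4)) ⊕ (Σ l : Fin L, (Fin (l + 1) → S) → ℤˣ),
      dominantWeight κ S ω ≤ 1 := by
  rw [Fintype.sum_sum_type, Fintype.sum_sigma]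
  simp only [dominantWeight]
  have h1 : ∑ _p : Fin 9 × (κ → Fin 4), (1 : ℝ) / (10 * 4 ^ Fintype.card κ) = 9 / 10 := by
    simp only [Finset.sum_const, Finset.card_univ, Fintype.card_prod, Fintype.card_fin,
      Fintype.card_pi, Finset.prod_const, nsmul_eq_mul]
    push_cast
    field_simp
  have h2 : ∀ l : Fin L, ∑ _τ : (Fin (l + 1) → S) → ℤˣ,
      (1 : ℝ) / 40 * (3 / 4) ^ (l : ℕ) / 2 ^ Fintype.card (Fin (l + 1) → S) =
        1 / 40 * (3 / 4) ^ (l : ℕ) := by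
    intro l
    rw [Finset.sum_const, Finset.card_univ, nsmul_eq_mul]
    have : (Fintype.card ((Fin (l + 1) → S) → ℤˣ) : ℝ) = 2 ^ Fintype.card (Fin (l + 1) → S) := by
      rw [Fintype.card_fun]; norm_num
    rw [this]
    field_simp
  rw [h1, Finset.sum_congr rfl fun l _ => h2 l, ← Finset.mul_sum]
  have := sum_three_quarters_pow_le L
  linarith

/-- The variable `X` in `hx` stands for the maximum over the labels `k ≠ y i`. The constants
balance: `2 * 5 / 10 = 1` for the sign patterns, and `160 / 40 * (3/4 * 2/3) ^ l = 2 * 2 * (1/2) ^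
l` for the codes. -/
theorem le_average_dominant (f : κ → ι → T → ℝ) (y : ι → κ) {S : Type*} [Fintype S]
    [DecidableEq S] (digit : ℕ → T → S) (v : T → V) {ρ : ℝ} (hρ : 0 ≤ ρ)
    (hdigit : ∀ l a a', (∀ j < l, digit j a = digit j a') → ‖v a - v a'‖ ≤ 2 * ρ * (1 / 2) ^ l)
    (L : ℕ) (i : ι) (a a' : T) (x : ℝ)
    (hx : ∀ X : ℝ, (∀ k ≠ y i,
      |(f (y i) i a - f (y i) i a') - (f k i a - f k i a')| ≤ X) → x ≤ X + 2 * ‖v a - v a'‖) :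
    x ≤ ∑ ω : (Fin 9 × (κ → Fin 4)) ⊕ (Σ l : Fin L, (Fin (l + 1) → S) → ℤˣ),
      dominantWeight κ S ω * |dominant f y digit ρ i ω a - dominant f y digit ρ i ω a'| +
        4 * ρ * (1 / 2) ^ L := by
  rw [Fintype.sum_sum_type, Fintype.sum_sigma, Fintype.sum_prod_type]
  simp only [dominantWeight, dominant]
  refine (hx _ fun k hk => ?_).trans (add_le_add_right ?_ _ |>.trans_eq (add_assoc _ _ _).symm)
  · have h := five_abs_sub_le_average (fun k => f k i a - f k i a') (y i) k hk
    have h1 : ∀ (o : Fin 9) (ω : κ → Fin 4),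
        1 / (10 * 4 ^ Fintype.card κ) * |2 * ∑ j, signPattern (y i) o j (ω j) * f j i a -
          2 * ∑ j, signPattern (y i) o j (ω j) * f j i a'| =
        1 / (5 * 4 ^ Fintype.card κ) *
          |∑ j, signPattern (y i) o j (ω j) * (f j i a - f j i a')| := by
      intro o ω
      rw [← mul_sub, ← Finset.sum_sub_distrib, abs_mul, abs_two]
      simp only [mul_sub]
      field_simp
      ring
    simp only [h1, ← Finset.mul_sum]
    rw [one_div, ← div_eq_inv_mul, le_div_iff₀ (by positivity)]
    linarith
  · have h := norm_sub_le_sum_indicator v ρ hρ digit hdigit L a a'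
    have h1 : ∀ l : Fin L, ∑ τ : (Fin (l + 1) → S) → ℤˣ,
        1 / 40 * (3 / 4) ^ (l : ℕ) / 2 ^ Fintype.card (Fin (l + 1) → S) *
          |160 * ρ * (2 / 3) ^ (l : ℕ) * ((τ fun j => digit j a : ℤˣ) : ℤ) -
            160 * ρ * (2 / 3) ^ (l : ℕ) * ((τ fun j => digit j a' : ℤˣ) : ℤ)| =
        2 * (2 * ρ * (1 / 2) ^ (l : ℕ) *
          (if (fun j : Fin (l + 1) => digit j a) = (fun j : Fin (l + 1) => digit j a')
            then 0 else 1)) := by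
      intro l
      have h2 : (0 : ℝ) ≤ 160 * ρ * (2 / 3) ^ (l : ℕ) := by positivity
      simp only [← mul_sub, abs_mul (160 * ρ * (2 / 3) ^ (l : ℕ)), abs_of_nonneg h2]
      rw [← Finset.mul_sum, ← Finset.mul_sum, sum_abs_sign_sub]
      -- The decay `2⁻ˡ` is shared out: `(3/4) ^ l` keeps the weights summable, `(2/3) ^ l` the
      -- Massart bounds.
      have h3 : ((1 : ℝ) / 2) ^ (l : ℕ) = (3 / 4) ^ (l : ℕ) * (2 / 3) ^ (l : ℕ) := by
        rw [← mul_pow]; norm_num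
      rw [h3]
      field_simp
      split_ifs <;> ring
    simp only [h1, ← Finset.mul_sum]
    linarith

/-- The Rademacher average of a selection of dominating functions. -/
theorem radSum_dominant_le (f : κ → ι → T → ℝ) (y : ι → κ) {S : Finset V} (hS : S.Nonempty)
    (hcard : S.card ≤ 5 ^ Module.finrank ℝ V) {D : ℕ} (hD : Module.finrank ℝ V ≤ D) (hD0 : 0 < D)
    (digit : ℕ → T → S) {ρ : ℝ} (hρ : 0 ≤ ρ) (L : ℕ)
    (ω : ι → Option ((Fin 9 × (κ → Fin 4)) ⊕ (Σ l : Fin L, (Fin (l + 1) → S) → ℤˣ))) :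
    radSum (fun i => (ω i).elim 0 (dominant f y digit ρ i)) ≤
      2 * ∑ k, radSum (f k) +
        2 ^ Fintype.card ι * (2880 * ρ * √(Fintype.card ι * D)) := by
  classical
  have : Nonempty S := hS.to_subtype
  -- A selection splits into a combination of scores and a sum over scales. At each `i` at most one
  -- of these pieces is nonzero, so each may be completed by zeros and bounded separately.
  let c : κ → ι → ℝ := fun k i => match ω i with
    | some (.inl p) => 2 * signPattern (y i) p.1 k (p.2 k)
    | _ => 0
  let g : (l : Fin L) → ι → (Fin (l + 1) → S) → ℝ := fun l i z => match ω i with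
    | some (.inr p) => if h : p.1 = l then
        160 * ρ * (2 / 3) ^ (l : ℕ) * ((h ▸ p.2 : (Fin (l + 1) → S) → ℤˣ) z : ℤˣ) else 0
    | _ => 0
  have hdec : (fun i => (ω i).elim 0 (dominant f y digit ρ i)) = fun i t =>
      ∑ k, c k i * f k i t + ∑ l : Fin L, g l i (fun j => digit j t) := by
    funext i t
    rcases h : ω i with _ | (p | p)
    · simp [c, g, h]
    · simp [c, g, h, dominant, Finset.mul_sum, mul_assoc]
    · simp only [Option.elim, dominant, c, g, h, zero_mul, Finset.sum_const_zero, zero_add]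
      rw [Finset.sum_eq_single p.1]
      · simp
      · intro l _ hl
        rw [dif_neg hl.symm]
      · simp
  rw [hdec]
  refine (radSum_add_le _ _).trans (add_le_add ?_ ?_)
  · rw [Finset.mul_sum]
    refine (radSum_sum_le Finset.univ fun k i t => c k i * f k i t).trans
      (Finset.sum_le_sum fun k _ => radSum_mul_le (c k) 2 zero_le_two (fun i => ?_) (f k))
    simp only [c]
    split
    · rw [abs_mul, abs_two]
      linarith [abs_signPattern_le (y i) (‹Fin 9 × (κ → Fin 4)›).1 k ((‹Fin 9 × (κ → Fin 4)›).2 k)]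
    · simp
  · refine (radSum_sum_le Finset.univ fun (l : Fin L) i t => g l i fun j => digit j t).trans ?_
    have hl : ∀ l : Fin L, radSum (fun i t => g l i fun j => digit j t) ≤
        2 ^ Fintype.card ι * (320 * ρ * √(Fintype.card ι * D)) *
          (((l : ℕ) + 1) * (2 / 3) ^ (l : ℕ)) := by
      intro l
      have h1 : (0 : ℝ) ≤ 160 * ρ * (2 / 3) ^ (l : ℕ) := by positivity
      refine (radSum_comp_le (fun t (j : Fin (l + 1)) => digit j t) (g l)
        (160 * ρ * (2 / 3) ^ (l : ℕ)) h1 (fun i z => ?_) _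
        (log_card_codes_le hS hcard hD l) (by positivity)).trans ?_
      · simp only [g]
        split
        · split_ifs with h
          · subst h
            rw [abs_mul, abs_of_nonneg h1]
            refine mul_le_of_le_one_right h1 (le_of_eq ?_)
            rcases sign_cast_cases ((‹Σ l : Fin L, (Fin (l + 1) → S) → ℤˣ›).2 z) with h | h <;>
              simp [h]
          · simpa using h1
        · simpa using h1
      -- The cheap bound `√(l + 1) ≤ l + 1` is enough for the sum over scales, whose value 9 gives
      -- `320 * 9 = 2880`.
      · have h2 : √(2 * (Fintype.card ι : ℝ) * (2 * (((l : ℕ) + 1) * D))) ≤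
            2 * ((l : ℕ) + 1) * √(Fintype.card ι * D) := by
          have e : 2 * (Fintype.card ι : ℝ) * (2 * (((l : ℕ) + 1) * D)) =
              (2 : ℝ) ^ 2 * ((l : ℕ) + 1) * (Fintype.card ι * D) := by ring
          rw [e, Real.sqrt_mul (by positivity), Real.sqrt_mul (by positivity),
            Real.sqrt_sq zero_le_two]
          gcongr
          rw [Real.sqrt_le_left (by positivity)]
          nlinarith [(Nat.cast_nonneg (l : ℕ) : (0 : ℝ) ≤ _)]
        calc _ ≤ 2 ^ Fintype.card ι * (160 * ρ * (2 / 3) ^ (l : ℕ) *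
              (2 * ((l : ℕ) + 1) * √(Fintype.card ι * D))) := by gcongr
          _ = _ := by ring
    refine (Finset.sum_le_sum fun l _ => hl l).trans ?_
    rw [← Finset.mul_sum]
    have h3 := mul_le_mul_of_nonneg_left (sum_succ_mul_two_thirds_pow_le L)
      (by positivity : 0 ≤ 2 ^ Fintype.card ι * (320 * ρ * √(Fintype.card ι * D)))
    linarith

/-- The Rademacher average of functions that depend Lipschitz continuously on the differences of
score functions and on a vector in a space of dimension `D`. -/
theorem radSum_le_of_lipschitz (f : κ → ι → T → ℝ) (y : ι → κ) (v : T → V) {ρ : ℝ} (hρ : 0 ≤ ρ)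
    (hv : ∀ t, ‖v t‖ ≤ ρ) {D : ℕ} (hD : Module.finrank ℝ V ≤ D) (hD0 : 0 < D)
    (ψ : ι → T → ℝ) {e : ℝ} (he : 0 ≤ e)
    (hψ : ∀ i a a' (X : ℝ), (∀ k ≠ y i,
      |(f (y i) i a - f (y i) i a') - (f k i a - f k i a')| ≤ X) →
        ψ i a - ψ i a' ≤ X + 2 * ‖v a - v a'‖ + e) :
    radSum ψ ≤ 2 * ∑ k, radSum (f k) +
      2 ^ Fintype.card ι * (2880 * ρ * √(Fintype.card ι * D)) +
        Fintype.card ι * 2 ^ Fintype.card ι * e := by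
  classical
  obtain ⟨S, digit, hS, hcard, hdigit⟩ := exists_digits v ρ hv
  -- The bound is uniform in the depth `L` of the expansion, except for the truncation error, which
  -- vanishes in the limit.
  have hL : ∀ L : ℕ, radSum ψ ≤ 2 * ∑ k, radSum (f k) +
      2 ^ Fintype.card ι * (2880 * ρ * √(Fintype.card ι * D)) +
        Fintype.card ι * 2 ^ Fintype.card ι * (4 * ρ * (1 / 2) ^ L + e) := fun L =>
    radSum_le_of_average ψ (dominantWeight κ S) (dominant f y digit ρ (L := L))
      dominantWeight_nonneg sum_dominantWeight_le _ (by positivity)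
      (fun i a a' => by
        have := le_average_dominant f y digit v hρ hdigit L i a a' (ψ i a - ψ i a' - e)
          fun X hX => by linarith [hψ i a a' X hX]
        linarith) _
      (radSum_dominant_le f y hS hcard hD hD0 digit hρ L)
  have hlim : Filter.Tendsto (fun L : ℕ => 2 * ∑ k, radSum (f k) +
      2 ^ Fintype.card ι * (2880 * ρ * √(Fintype.card ι * D)) +
        Fintype.card ι * 2 ^ Fintype.card ι * (4 * ρ * (1 / 2) ^ L + e)) Filter.atTop
      (nhds (2 * ∑ k, radSum (f k) + 2 ^ Fintype.card ι * (2880 * ρ * √(Fintype.card ι * D)) +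
        Fintype.card ι * 2 ^ Fintype.card ι * (4 * ρ * 0 + e))) :=
    (((tendsto_pow_atTop_nhds_zero_of_lt_one (by norm_num) (by norm_num)).const_mul
      (4 * ρ)).add_const e |>.const_mul _).const_add _
  simpa using ge_of_tendsto' hlim hL

end Chaining

/-! ### Lipschitz bounds for the ramp and the margin -/

section Loss

theorem ramp_le_one {γ : ℝ} (hγ : 0 < γ) (t : ℝ) : ramp γ t ≤ 1 := by
  unfold ramp
  split_ifs with h1 h2
  · exact le_rfl
  · have : 0 ≤ t / γ := div_nonneg (not_le.1 h1).le hγ.le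
    linarith
  · exact zero_le_one

/-- `γ * ramp γ t` is `γ - t` clamped to `[0, γ]`, and clamping is 1-Lipschitz. -/
theorem mul_ramp_sub_le {γ : ℝ} (hγ : 0 < γ) (t t' : ℝ) :
    γ * (ramp γ t - ramp γ t') ≤ |t - t'| := by
  have key : ∀ t, γ * ramp γ t = max 0 (γ - max 0 t) := by
    intro t
    unfold ramp
    split_ifs with h1 h2
    · rw [max_eq_left h1, sub_zero, max_eq_right hγ.le, mul_one]
    · rw [max_eq_right (not_le.1 h1).le, max_eq_right (by linarith)]
      field_simp
    · rw [max_eq_right (not_le.1 h1).le, max_eq_left (by linarith), mul_zero]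
  rw [mul_sub, key, key]
  refine (le_abs_self _).trans ?_
  calc _ ≤ |(γ - max 0 t) - (γ - max 0 t')| := by
        simpa [max_comm] using abs_max_sub_max_le_abs (γ - max 0 t) (γ - max 0 t') 0
    _ = |max 0 t' - max 0 t| := by congr 1; ring
    _ ≤ |t' - t| := by simpa [max_comm] using abs_max_sub_max_le_abs t' t 0
    _ = _ := abs_sub_comm _ _

theorem margin_sub_le {K : ℕ} (hK : 2 ≤ K) (v v' : Fin K → ℝ) (y : Fin K) (X : ℝ)
    (h : ∀ k ≠ y, |(v y - v' y) - (v k - v' k)| ≤ X) : margin v y - margin v' y ≤ X := by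
  have : Nontrivial (Fin K) := Fin.nontrivial_iff_two_le.2 hK
  obtain ⟨k0, hk0⟩ := exists_ne y
  have : Nonempty {k : Fin K // k ≠ y} := ⟨⟨k0, hk0⟩⟩
  have h1 : (⨆ k : {k : Fin K // k ≠ y}, v' k) ≤
      (⨆ k : {k : Fin K // k ≠ y}, v k) + X - (v y - v' y) := by
    refine ciSup_le fun k => ?_
    have h2 := le_ciSup_fintype (fun k : {k : Fin K // k ≠ y} => v k) k
    have h3 := (abs_le.1 (h k k.2)).2
    linarith
  unfold margin
  linarith

theorem abs_margin_sub_le {K : ℕ} (hK : 2 ≤ K) (v v' : Fin K → ℝ) (y : Fin K) (X : ℝ)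
    (h : ∀ k ≠ y, |(v y - v' y) - (v k - v' k)| ≤ X) : |margin v y - margin v' y| ≤ X := by
  refine abs_le.2 ⟨?_, margin_sub_le hK v v' y X h⟩
  have := margin_sub_le hK v' v y X fun k hk => by
    rw [← abs_neg]
    convert h k hk using 2
    ring
  linarith

end Loss

/-! ### Passage between Rademacher complexities and finite families -/

section Rademacher

variable {m : ℕ}

/-- A Rademacher complexity is approximated by that of a finite family. -/
theorem exists_rademacher_le {V : Set (Fin m → ℝ)} (hV : V.Nonempty) {η : ℝ} (hη : 0 < η) :
    ∃ a : (Fin m → ℤˣ) → Fin m → ℝ, (∀ σ, a σ ∈ V) ∧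
      rademacher V ≤ radSum (fun i σ => a σ i) / (m * 2 ^ m) + η := by
  have h : ∀ σ : Fin m → ℤˣ, ∃ a ∈ V,
      sSup ((fun a : Fin m → ℝ => (1 / (m : ℝ)) * ∑ i, (((σ i : ℤ) : ℝ)) * a i) '' V) - η <
        (1 / (m : ℝ)) * ∑ i, (((σ i : ℤ) : ℝ)) * a i := by
    intro σ
    obtain ⟨_, ⟨a, ha, rfl⟩, h⟩ := exists_lt_of_lt_csSup (hV.image _) (sub_lt_self _ hη)
    exact ⟨a, ha, h⟩
  choose a ha h using h
  refine ⟨a, ha, ?_⟩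
  rw [rademacher, ← div_div, div_add' _ _ _ (by positivity), div_le_div_iff_of_pos_right
    (by positivity)]
  have hη' : η * 2 ^ m = ∑ _σ : Fin m → ℤˣ, η := by
    rw [Finset.sum_const, Finset.card_univ, nsmul_eq_mul, Fintype.card_fun]
    simp [mul_comm]
  rw [hη', radSum, Finset.sum_div, ← Finset.sum_add_distrib]
  refine Finset.sum_le_sum fun σ _ => ?_
  have h1 := le_ciSup_fintype (fun τ => ∑ i, ((σ i : ℤ) : ℝ) * a τ i) σ
  have h2 := div_le_div_of_nonneg_right h1 (Nat.cast_nonneg (α := ℝ) m)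
  have h3 := h σ
  rw [one_div_mul_eq_div] at h3
  linarith

/-- The uniform bound `c` is needed because `sSup` of an unbounded set of reals is 0. -/
theorem radSum_le_rademacher (hm : 0 < m) {T : Type*} [Fintype T] [Nonempty T]
    {V : Set (Fin m → ℝ)} {c : ℝ} (hc : ∀ a ∈ V, ∀ i, |a i| ≤ c) (a : T → Fin m → ℝ)
    (ha : ∀ t, a t ∈ V) : radSum (fun i t => a t i) ≤ m * 2 ^ m * rademacher V := by
  have hm' : (0 : ℝ) < m := by exact_mod_cast hm
  rw [rademacher, mul_assoc, mul_div_cancel₀ _ (by positivity), Finset.mul_sum]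
  refine radSum_le_of_forall fun σ t => ?_
  rw [← div_le_iff₀' hm', ← one_div_mul_eq_div]
  refine le_csSup ⟨1 / (m : ℝ) * ∑ _i : Fin m, c, ?_⟩ ⟨a t, ha t, rfl⟩
  rintro _ ⟨a, ha, rfl⟩
  refine mul_le_mul_of_nonneg_left (Finset.sum_le_sum fun i _ => ?_) (by positivity)
  refine (le_abs_self _).trans ?_
  rw [abs_mul]
  have h1 : |((σ i : ℤ) : ℝ)| = 1 := by
    rcases sign_cast_cases (σ i) with h | h <;> simp [h]
  rw [h1, one_mul]
  exact hc a ha i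

end Rademacher

/-! ### The adversarial bound -/

section Main

variable {d n K m : ℕ}

theorem zero_mem_observables {r : ℝ≥0∞} (hr : 1 ≤ r) {b : ℝ} (hb : 0 ≤ b) :
    (0 : Matrix (Fin n) (Fin n) ℂ) ∈ observables n r b :=
  ⟨Matrix.isHermitian_zero, (schattenNorm_zero hr).trans_le hb⟩

theorem IsDensity.pos {ρ : Matrix (Fin n) (Fin n) ℂ} (h : IsDensity ρ) : 0 < n := by
  rcases Nat.eq_zero_or_pos n with rfl | hn
  · have := h.2
    simp [Matrix.trace] at this
  · exact hn

theorem componentRademacher_eq (hK : 0 < K) (emb : (Fin d → ℝ) → Matrix (Fin n) (Fin n) ℂ)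
    (r : ℝ≥0∞) (b : ℝ) (x : Fin m → Fin d → ℝ) :
    componentRademacher K emb r b x = binaryRademacher emb r b x := by
  unfold componentRademacher binaryRademacher
  congr 1
  ext a
  constructor
  · rintro ⟨A, hA, k, rfl⟩
    exact ⟨A k, hA k, rfl⟩
  · rintro ⟨A, hA, rfl⟩
    exact ⟨fun _ => A, fun _ => hA, ⟨0, hK⟩, rfl⟩

/-- The scores of all the observables on a finite family of matrices. -/
def scoreMap (n K : ℕ) {P : Type*} (B : P → Matrix (Fin n) (Fin n) ℂ) :
    (Fin K → Matrix (Fin n) (Fin n) ℂ) →ₗ[ℝ] (Fin K × P → ℝ) where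
  toFun A := fun p => score (A p.1) (B p.2)
  map_add' A A' := by
    funext p
    simp [score, Matrix.add_mul]
  map_smul' c A := by
    funext p
    simp [score]

/-- The reason for working in the range and not in the whole coordinate space: its dimension is
controlled by the matrices alone, however large `P` is. -/
theorem finrank_range_scoreMap_le {P : Type*} (B : P → Matrix (Fin n) (Fin n) ℂ) :
    Module.finrank ℝ (LinearMap.range (scoreMap n K B)) ≤ K * (n * n * 2) := by
  refine (LinearMap.finrank_range_le _).trans_eq ?_
  rw [Module.finrank_pi_fintype]
  simp [Module.finrank_matrix]

theorem bddAbove_loss {γ : ℝ} (hγ : 0 < γ) (A : Fin K → Matrix (Fin n) (Fin n) ℂ) (y : Fin K)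
    (s : Set (Matrix (Fin n) (Fin n) ℂ)) : BddAbove ((fun ρ' => loss γ A ρ' y) '' s) :=
  ⟨1, by rintro _ ⟨ρ', _, rfl⟩; exact ramp_le_one hγ _⟩

/-- The bound for any adversary that replaces the state of `x i` by one at distance at most `s`. -/
theorem advRademacher_le (hK : 2 ≤ K) (hm : 1 ≤ m)
    (emb : (Fin d → ℝ) → Matrix (Fin n) (Fin n) ℂ)
    (attack : (Fin d → ℝ) → Set (Matrix (Fin n) (Fin n) ℂ)) {r : ℝ≥0∞} (hr : 1 ≤ r)
    {b γ s : ℝ} (hb : 0 ≤ b) (hγ : 0 < γ) (hs : 0 ≤ s) (x : Fin m → Fin d → ℝ)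
    (hx : ∀ i, IsDensity (emb (x i))) (y : Fin m → Fin K)
    (hne : ∀ i, (attack (x i)).Nonempty) (hatt : ∀ i, ∀ ρ' ∈ attack (x i), IsDensity ρ')
    (hdist : ∀ i, ∀ ρ' ∈ attack (x i),
      schattenNorm (ENNReal.conjExponent r) (emb (x i) - ρ') ≤ s) :
    advRademacher attack r b γ x y ≤ 2 * K / γ * binaryRademacher emb r b x +
      K * b * (n * s) * 2880 / (γ * √m) := by
  have hm0 : (0 : ℝ) < m := by exact_mod_cast hm
  have hK0 : (2 : ℝ) ≤ K := by exact_mod_cast hK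
  have hn : 0 < n := (hx ⟨0, hm⟩).pos
  have hc : 1 ≤ ENNReal.conjExponent r := by simp [ENNReal.conjExponent]
  refine le_of_forall_pos_le_add fun η' hη' => ?_
  -- One `η` is spent on the near-maximisers over observables, the other on the near-optimal
  -- attacks.
  obtain ⟨η, hη, rfl⟩ : ∃ η > 0, η' = 2 * η := ⟨η' / 2, by positivity, by ring⟩
  obtain ⟨a, ha, hle⟩ := exists_rademacher_le (V := {a : Fin m → ℝ |
    ∃ A : Fin K → Matrix (Fin n) (Fin n) ℂ, (∀ k, A k ∈ observables n r b) ∧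
      a = fun i => advLoss attack γ A (x i) (y i)})
    ⟨_, fun _ => 0, fun _ => zero_mem_observables hr hb, rfl⟩ hη
  choose A hA haA using ha
  have hnear : ∀ i t, ∃ ρ' ∈ attack (x i),
      advLoss attack γ (A t) (x i) (y i) - η < loss γ (A t) ρ' (y i) := by
    intro i t
    obtain ⟨_, ⟨ρ', hρ', rfl⟩, h⟩ := exists_lt_of_lt_csSup
      ((hne i).image fun ρ' => loss γ (A t) ρ' (y i)) (sub_lt_self _ hη)
    exact ⟨ρ', hρ', h⟩
  choose ρ' hρ' hnear using hnear
  -- All the chosen attack states serve as coordinates, so one vector controls the perturbed scores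
  -- of every `A t` in every chosen state.
  let Φ := scoreMap n K fun p : Fin m × (Fin m → ℤˣ) => ρ' p.1 p.2 - emb (x p.1)
  let v : (Fin m → ℤˣ) → LinearMap.range Φ := fun t => ⟨Φ (A t), A t, rfl⟩
  have hv : ∀ t, ‖v t‖ ≤ b * s := by
    intro t
    refine (pi_norm_le_iff_of_nonneg (by positivity)).2 fun p => ?_
    change |score (A t p.1) (ρ' p.2.1 p.2.2 - emb (x p.2.1))| ≤ b * s
    have hH := (hatt _ _ (hρ' p.2.1 p.2.2)).1.isHermitian
    have hE := (hx p.2.1).1.isHermitian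
    rw [← abs_neg, score_sub_right, neg_sub, ← score_sub_right]
    refine (abs_score_le hr (hA t p.1).1 (hE.sub hH)).trans ?_
    exact mul_le_mul (hA t p.1).2 (hdist _ _ (hρ' _ _)) (schattenNorm_nonneg hc _) hb
  have hcoord : ∀ t t' i u k, |score (A t k) (ρ' i u - emb (x i)) -
      score (A t' k) (ρ' i u - emb (x i))| ≤ ‖v t - v t'‖ := fun t t' i u k =>
    norm_le_pi_norm (Φ (A t) - Φ (A t')) (k, (i, u))
  have hmain := radSum_le_of_lipschitz (fun k i t => score (A t k) (emb (x i))) y v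
    (by positivity : 0 ≤ b * s) hv (finrank_range_scoreMap_le _)
    (by positivity : 0 < K * (n * n * 2))
    (fun i t => γ * a t i) (by positivity : 0 ≤ γ * η) (by
      intro i t t' X hX
      -- The state chosen against `A t` is also available against `A t'`, so both losses can be
      -- compared in this one state and the supremum over attacks disappears.
      have h1 : loss γ (A t') (ρ' i t) (y i) ≤ advLoss attack γ (A t') (x i) (y i) :=
        le_csSup (bddAbove_loss hγ _ _ _) ⟨_, hρ' i t, rfl⟩
      have h2 := hnear i t
      have h3 : γ * (loss γ (A t) (ρ' i t) (y i) - loss γ (A t') (ρ' i t) (y i)) ≤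
          X + 2 * ‖v t - v t'‖ := by
        refine (mul_ramp_sub_le hγ _ _).trans (abs_margin_sub_le hK _ _ _ _ fun k hk => ?_)
        have e : ∀ (t : Fin m → ℤˣ) (u : Fin m → ℤˣ) k, score (A t k) (ρ' i u) =
            score (A t k) (emb (x i)) + score (A t k) (ρ' i u - emb (x i)) := by
          intro t u k
          rw [score_sub_right]; ring
        have c1 := abs_le.1 (hcoord t t' i t (y i))
        have c2 := abs_le.1 (hcoord t t' i t k)
        have c3 := abs_le.1 (hX k hk)
        simp only [e]
        exact abs_le.2 ⟨by linarith [c1.1, c2.2, c3.1], by linarith [c1.2, c2.1, c3.2]⟩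
      have h4 : γ * (a t i - a t' i) ≤
          γ * (loss γ (A t) (ρ' i t) (y i) - loss γ (A t') (ρ' i t) (y i)) + γ * η := by
        rw [← mul_add, haA t, haA t']
        exact mul_le_mul_of_nonneg_left (by linarith) hγ.le
      linarith)
  rw [radSum_const_mul hγ.le, Fintype.card_fin] at hmain
  have hf : ∀ k : Fin K, radSum (fun i t => score (A t k) (emb (x i))) ≤
      m * 2 ^ m * binaryRademacher emb r b x := by
    intro k
    refine radSum_le_rademacher hm (c := b * n) ?_ (fun t i => score (A t k) (emb (x i)))
      fun t => ⟨A t k, hA t k, rfl⟩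
    rintro _ ⟨A, hA, rfl⟩ i
    exact (abs_score_le hr hA.1 (hx i).1.isHermitian).trans
      (mul_le_mul hA.2 (schattenNorm_density_le hc (hx i)) (schattenNorm_nonneg hc _) hb)
  have hf' := Finset.sum_le_sum fun k (_ : k ∈ Finset.univ) => hf k
  rw [Finset.sum_const, Finset.card_univ, Fintype.card_fin, nsmul_eq_mul] at hf'
  -- From `K ≥ 2`: `2 K n² ≤ (K n)²`.
  have hsqrt : √((m : ℝ) * (K * (n * n * 2) : ℕ)) ≤ √m * (K * n) := by
    rw [Real.sqrt_mul hm0.le]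
    refine mul_le_mul_of_nonneg_left (Real.sqrt_le_left (by positivity) |>.2 ?_)
      (Real.sqrt_nonneg _)
    push_cast
    nlinarith [mul_le_mul_of_nonneg_right hK0 (by positivity : (0 : ℝ) ≤ K * (n * n))]
  have hmm : √(m : ℝ) * √m = m := Real.mul_self_sqrt hm0.le
  have hsm : 0 < √(m : ℝ) := Real.sqrt_pos.2 hm0
  have hbound : γ * radSum (fun i t => a t i) ≤
      2 * (K * (m * 2 ^ m * binaryRademacher emb r b x)) +
        2 ^ m * (2880 * (b * s) * (√m * (K * n))) + m * 2 ^ m * (γ * η) := by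
    refine hmain.trans ?_
    gcongr
  have hfin : radSum (fun i t => a t i) / (m * 2 ^ m) ≤
      2 * K / γ * binaryRademacher emb r b x + K * b * (n * s) * 2880 / (γ * √m) + η := by
    rw [div_le_iff₀ (by positivity)]
    refine le_of_mul_le_mul_left (hbound.trans_eq ?_) hγ
    have e : K * b * (n * s) * 2880 / (γ * √m) * (m * 2 ^ m) =
        K * b * (n * s) * 2880 / γ * √m * 2 ^ m := by
      rw [div_mul_eq_mul_div, div_eq_iff (by positivity)]
      field_simp
      rw [Real.sq_sqrt hm0.le]
    rw [add_mul, add_mul, e]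
    field_simp
  exact (hle.trans (add_le_add_left hfin η)).trans_eq (by ring)

theorem le_sSup_distance {X : Set (Fin d → ℝ)} {emb : (Fin d → ℝ) → Matrix (Fin n) (Fin n) ℂ}
    (hemb : ∀ x ∈ X, IsDensity (emb x)) {attack : (Fin d → ℝ) → Set (Matrix (Fin n) (Fin n) ℂ)}
    (hatt : ∀ x ∈ X, ∀ ρ' ∈ attack x, IsDensity ρ') {q : ℝ≥0∞} (hq : 1 ≤ q) {x : Fin d → ℝ}
    (hx : x ∈ X) {ρ' : Matrix (Fin n) (Fin n) ℂ} (hρ' : ρ' ∈ attack x) :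
    schattenNorm q (emb x - ρ') ≤
      sSup {s : ℝ | ∃ x ∈ X, ∃ ρ' ∈ attack x, s = schattenNorm q (emb x - ρ')} := by
  refine le_csSup ⟨2 * n, ?_⟩ ⟨x, hx, ρ', hρ', rfl⟩
  rintro _ ⟨x, hx, ρ', hρ', rfl⟩
  exact schattenNorm_sub_le hq (hemb x hx) (hatt x hx ρ' hρ')

theorem advRademacher_le_excess (hK : 2 ≤ K) (hm : 1 ≤ m) {X : Set (Fin d → ℝ)}
    {emb : (Fin d → ℝ) → Matrix (Fin n) (Fin n) ℂ} (hemb : ∀ x ∈ X, IsDensity (emb x))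
    {attack : (Fin d → ℝ) → Set (Matrix (Fin n) (Fin n) ℂ)}
    (hatt : ∀ x ∈ X, ∀ ρ' ∈ attack x, IsDensity ρ') (hne : ∀ x ∈ X, (attack x).Nonempty)
    {r : ℝ≥0∞} (hr : 1 ≤ r) {b γ : ℝ} (hb : 0 ≤ b) (hγ : 0 < γ) (x : Fin m → Fin d → ℝ)
    (hx : ∀ i, x i ∈ X) (y : Fin m → Fin K) :
    advRademacher attack r b γ x y ≤ 2 * K / γ * componentRademacher K emb r b x +
      K * b * excess X emb attack r * 2880 / (γ * √m) := by
  have hc : 1 ≤ ENNReal.conjExponent r := by simp [ENNReal.conjExponent]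
  rw [componentRademacher_eq (by omega)]
  refine advRademacher_le hK hm emb attack hr hb hγ (Real.sSup_nonneg ?_) x
    (fun i => hemb _ (hx i)) y (fun i => hne _ (hx i)) (fun i => hatt _ (hx i))
    fun i ρ' hρ' => le_sSup_distance hemb hatt hc (hx i) hρ'
  rintro _ ⟨x, _, ρ', _, rfl⟩
  exact schattenNorm_nonneg hc _

end Main

end QClassifier

end

theorem theorem5 :
    ∃ J : ℝ≥0∞ → ℝ,
      (∃ C : ℝ, ∀ r : ℝ≥0∞, 1 ≤ r → 0 ≤ J r ∧ J r ≤ C * √(1 + (1 / r).toReal)) ∧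
      ∀ (d n K m : ℕ) (_ : 2 ≤ K) (_ : 1 ≤ m)
        (X : Set (Fin d → ℝ)) (emb : (Fin d → ℝ) → Matrix (Fin n) (Fin n) ℂ)
        (_ : ∀ x ∈ X, QClassifier.IsDensity (emb x))
        (r p : ℝ≥0∞) (_ : 1 ≤ r) (_ : 1 ≤ p)
        (b ε γ : ℝ) (_ : 0 ≤ b) (_ : 0 ≤ ε) (_ : 0 < γ)
        (x : Fin m → Fin d → ℝ) (_ : ∀ i, x i ∈ X) (y : Fin m → Fin K),
        -- classical attacks
        QClassifier.advRademacher (QClassifier.classicalAttack X emb p ε) r b γ x y ≤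
            2 * K / γ * QClassifier.componentRademacher K emb r b x +
              K * b * QClassifier.excess X emb (QClassifier.classicalAttack X emb p ε) r * J r /
                (γ * √m) ∧
        -- quantum attacks
        QClassifier.advRademacher (QClassifier.quantumAttack emb p ε) r b γ x y ≤
            2 * K / γ * QClassifier.componentRademacher K emb r b x +
              K * b * QClassifier.excess X emb (QClassifier.quantumAttack emb p ε) r * J r /
                (γ * √m) ∧
        -- the complexity in the first term is that of the binary class
        QClassifier.componentRademacher K emb r b x = QClassifier.binaryRademacher emb r b x := by
  -- A constant function is admissible because `√(1 + 1/r) ≥ 1`.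
  refine ⟨fun _ => 2880, ⟨2880, fun r _ => ⟨by norm_num, ?_⟩⟩, ?_⟩
  · have : 1 ≤ √(1 + (1 / r).toReal) := Real.one_le_sqrt.2 (by simp)
    linarith
  intro d n K m hK hm X emb hemb r p hr hp b ε γ hb hε hγ x hx y
  refine ⟨QClassifier.advRademacher_le_excess hK hm hemb ?_ ?_ hr hb hγ x hx y,
    QClassifier.advRademacher_le_excess hK hm hemb ?_ ?_ hr hb hγ x hx y,
    QClassifier.componentRademacher_eq (by omega) emb r b x⟩
  · rintro x - _ ⟨x', ⟨hx', _⟩, rfl⟩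
    exact hemb x' hx'
  · intro x hx
    refine ⟨emb x, x, ⟨hx, ?_⟩, rfl⟩
    rw [sub_self, QClassifier.lpNorm_zero hp]
    exact hε
  · rintro x - ρ' ⟨hρ', _⟩
    exact hρ'
  · intro x hx
    refine ⟨emb x, hemb x hx, ?_⟩
    rw [sub_self, QClassifier.schattenNorm_zero hp]
    exact hε
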